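/- Let $(M,m,V)$ be a natural mechanical system: $M$ is a smooth (finite-dimensional) manifold, $m=\langle\cdot,\cdot\rangle$ a smooth Riemannian metric on $M$, and $V$ a smooth function on $M$. Let $\theta_w(Y)=\langle w,Tp_M(Y)\rangle$ be the Lagrange 1-form of $m$ on $T(M)$, where $p_M:T(M)\to M$ is the projection, $\sigma=d\theta$, $K(w)=\frac12\langle w,w\rangle$, and $H=K+V\circ p_M$; the dynamical system of $(M,m,V)$ is the vector field $X$ on $T(M)$ determined by $i_X\sigma=-dH$. More generally, a mechanical system with gyroscopic forces $(N,n,U,\varkappa)$ consists of a manifold $N$, a Riemannian metric $n$ on $N$, a smooth function $U$ on $N$ and a smooth closed 2-form $\varkappa$ on $N$. Its dynamical system is the vector field $Y$ on $T(N)$ determined by $i_Y(\sigma_n+p_N^*\varkappa)=-d(K_n+U\circ p_N)$, where $\sigma_n$ and $K_n$ are the Lagrange 2-form and the kinetic energy of $n$. Let $G=\{g^\tau\}$ be a one-parameter group (a one-dimensional Lie group with a surjective smooth homomorphism $\tau\mapsto g^\tau$ from $\mathbb R$) that acts smoothly on $M$, preserves $m$ and $V$, and makes $p:M\to\tilde M=M/G$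 a smooth principal $G$-bundle. Let $v(x)=\frac{d}{d\tau}\big|_{\tau=0}g^\tau(x)$ be the generating field, $J(w)=\langle v,w\rangle$ the momentum, $J_k=J^{-1}(k)$ for $k\in\mathbb R$, $J_k(x)=J_k\cap T_x(M)$, and $\rho_k=Tp|_{J_k}:J_k\to T(\tilde M)$. Let $\eta(w)=\langle v,w\rangle/\langle v,v\rangle$ be the form of the connection with horizontal subspaces $J_0(x)$, and $\gamma=d\eta$ its curvature form. Then for every $k\in\mathbb R$ the following objects exist and are unique: 1. the dynamical system $X$ of $(M,m,V)$; 2. the reduced system $\tilde X_k$, that is, the smooth vector field on $T(\tilde M)$ with $T\rho_k\circ X=\tilde X_k\circ\rho_k$ on $J_k$; 3. the smooth Riemannian metric $\tilde m$ on $\tilde M$ with $\tilde m(Tp(w_1),Tp(w_2))=\langle w_1,w_2\rangle$ for all $x\in M$ and $w_1,w_2\in J_0(x)$; 4. the function $\tilde V_k$ on $\tilde M$ with $\tilde V_k(p(x))=V(x)+\dfrac{k^2}{2\langle v(x),v(x)\rangle}$ for all $x\in M$, and it is smooth; 5. the 2-form $\tilde\gamma$ on $\tilde M$ with $\gamma=p^*\tilde\gamma$,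 and it is smooth and closed. Moreover, $\tilde X_k$ is the (unique) dynamical system of the mechanical system with gyroscopic forces $(\tilde M,\tilde m,\tilde V_k,k\,\tilde\gamma)$. -/

import Mathlib

open Set
open scoped Manifold ContDiff Topology

noncomputable section

namespace GyroReduction

/-! ### Differential forms on manifolds -/

section Forms

variable {E : Type*} [NormedAddCommGroup E] [NormedSpace ℝ E]
  {H : Type*} [TopologicalSpace H] (I : ModelWithCorners ℝ E H)
  {M : Type*} [TopologicalSpace M] [ChartedSpace H M]
  {E' : Type*} [NormedAddCommGroup E'] [NormedSpace ℝ E']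
  {H' : Type*} [TopologicalSpace H'] (I' : ModelWithCorners ℝ E' H')
  {M' : Type*} [TopologicalSpace M'] [ChartedSpace H' M']

variable (M) in
/-- Real-valued differential `n`-forms (not necessarily smooth ones) on the manifold `M`. -/
abbrev Form (n : ℕ) : Type _ := (x : M) → TangentSpace I x [⋀^Fin n]→L[ℝ] ℝ

/-- The pullback of a form under a map of manifolds. -/
def Form.pullback {n : ℕ} (f : M → M') (ξ : Form I' M' n) : Form I M n :=
  fun x => (ξ (f x)).compContinuousLinearMap (mfderiv I I' f x)

/-- The expression of a form in the preferred chart at `x₀`: the pullback of the form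
by the inverse of the chart, which is a form on the model vector space. -/
def Form.inChart {n : ℕ} (ξ : Form I M n) (x₀ : M) (y : E) : E [⋀^Fin n]→L[ℝ] ℝ :=
  (ξ ((extChartAt I x₀).symm y)).compContinuousLinearMap
    (mfderivWithin 𝓘(ℝ, E) I (extChartAt I x₀).symm (range I) y)

/-- A form is smooth if its expressions in charts are. -/
def Form.IsSmooth {n : ℕ} (ξ : Form I M n) : Prop :=
  ∀ x₀ : M, ContDiffOn ℝ ∞ (Form.inChart I ξ x₀) (extChartAt I x₀).target

/-- The exterior derivative, computed in a chart:
`dω (v₀, …, vₙ) = ∑ i, (-1) ^ i ∂_{vᵢ} ω (v₀, …, v̂ᵢ, …, vₙ)`. -/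
def Form.d {n : ℕ} (ξ : Form I M n) : Form I M (n + 1) :=
  fun x₀ =>
    (extDerivWithin (Form.inChart I ξ x₀) (range I)
      (extChartAt I x₀ x₀)).compContinuousLinearMap (mfderiv I 𝓘(ℝ, E) (extChartAt I x₀) x₀)

/-- The `1`-form given by a field of linear functionals. -/
def Form.ofCovector (α : (x : M) → TangentSpace I x →L[ℝ] ℝ) : Form I M 1 :=
  fun x => ContinuousAlternatingMap.ofSubsingleton ℝ (TangentSpace I x) ℝ (0 : Fin 1) (α x)

end Forms

/-! ### Natural systems and systems with gyroscopic forces -/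

section Systems

variable {E : Type*} [NormedAddCommGroup E] [NormedSpace ℝ E]
  {H : Type*} [TopologicalSpace H] (I : ModelWithCorners ℝ E H)
  (M : Type*) [TopologicalSpace M] [ChartedSpace H M] [IsManifold I ∞ M]

/-- Smooth Riemannian metrics on `M`. -/
abbrev Metric : Type _ :=
  Bundle.ContMDiffRiemannianMetric I ∞ E (fun x : M => TangentSpace I x)

/-- Smooth vector fields on the tangent bundle `T(M)`. -/
abbrev FieldOnTM : Type _ :=
  ContMDiffSection I.tangent (E × E) ∞
    (fun w : TangentBundle I M => TangentSpace I.tangent w)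

/-- A natural mechanical system `(M, m, V)`. -/
structure NaturalSystem where
  metric : Metric I M
  potential : M → ℝ
  smooth_potential : ContMDiff I 𝓘(ℝ, ℝ) ∞ potential

/-- A mechanical system with gyroscopic forces `(M, m, V, ϰ)`: a natural system with a smooth
closed `2`-form on `M`. -/
structure GyroscopicSystem extends NaturalSystem I M where
  force : Form I M 2
  smooth_force : Form.IsSmooth I force
  closed_force : Form.d I force = 0

variable {I M}

/-- The Lagrange `1`-form `θ_w(Y) = ⟨w, Tp_M(Y)⟩` on `T(M)`. -/
def lagrangeOne (m : Metric I M) : Form I.tangent (TangentBundle I M) 1 :=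
  Form.ofCovector I.tangent fun w =>
    (m.inner w.proj w.snd).comp
      (mfderiv I.tangent I (Bundle.TotalSpace.proj : TangentBundle I M → M) w)

/-- The Lagrange `2`-form `σ = dθ` on `T(M)`. -/
def lagrangeTwo (m : Metric I M) : Form I.tangent (TangentBundle I M) 2 :=
  Form.d I.tangent (lagrangeOne m)

/-- The total energy `H = K + V ∘ p_M`, with `K(w) = ⟨w, w⟩ / 2`. -/
def NaturalSystem.energy (S : NaturalSystem I M) (w : TangentBundle I M) : ℝ :=
  1 / 2 * S.metric.inner w.proj w.snd w.snd + S.potential w.proj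

/-- `X` is the dynamical system of the natural system `(M, m, V)`: `i_X σ = -dH`. -/
def NaturalSystem.IsDynamics (S : NaturalSystem I M) (X : FieldOnTM I M) : Prop :=
  ∀ (w : TangentBundle I M) (Y : TangentSpace I.tangent w),
    lagrangeTwo S.metric w ![X w, Y] = -(mfderiv I.tangent 𝓘(ℝ, ℝ) S.energy w Y)

/-- `X` is the dynamical system of the system with gyroscopic forces `(M, m, V, ϰ)`:
`i_X (σ + p_M^* ϰ) = -d(K + V ∘ p_M)`. -/
def GyroscopicSystem.IsDynamics (S : GyroscopicSystem I M) (X : FieldOnTM I M) : Prop :=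
  ∀ (w : TangentBundle I M) (Y : TangentSpace I.tangent w),
    (lagrangeTwo S.metric + Form.pullback I.tangent I
        (Bundle.TotalSpace.proj : TangentBundle I M → M) S.force) w ![X w, Y] =
      -(mfderiv I.tangent 𝓘(ℝ, ℝ) S.toNaturalSystem.energy w Y)

end Systems

/-! ### One-parameter symmetry groups and reduction -/

/-- A smooth parametrization `τ ↦ g^τ` of a Lie group by the real line: a surjective smooth
homomorphism. -/
structure OneParameterGroup (F : Type*) [NormedAddCommGroup F] [NormedSpace ℝ F]
    (G : Type*) [TopologicalSpace G] [ChartedSpace F G] [Group G] where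
  g : ℝ → G
  map_add : ∀ s t, g (s + t) = g s * g t
  smooth : ContMDiff 𝓘(ℝ, ℝ) 𝓘(ℝ, F) ∞ g
  surjective : Function.Surjective g

section Reduction

variable {E : Type*} [NormedAddCommGroup E] [NormedSpace ℝ E]
  {H : Type*} [TopologicalSpace H] {I : ModelWithCorners ℝ E H}
  {M : Type*} [TopologicalSpace M] [ChartedSpace H M] [IsManifold I ∞ M]
  {E' : Type*} [NormedAddCommGroup E'] [NormedSpace ℝ E']
  {H' : Type*} [TopologicalSpace H'] {I' : ModelWithCorners ℝ E' H'}
  {M' : Type*} [TopologicalSpace M'] [ChartedSpace H' M'] [IsManifold I' ∞ M']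
  {F : Type*} [NormedAddCommGroup F] [NormedSpace ℝ F]
  {G : Type*} [TopologicalSpace G] [ChartedSpace F G] [Group G] [MulAction G M]

variable (I I' F G) in
/-- `(M, p, M')` is a smooth principal `G`-bundle: `p` is smooth and every point of the base lies
in an open set `U` over which there is a `G`-equivariant diffeomorphism `p⁻¹(U) ≃ U × G` over `U`.
(So `p` is onto, the action is free, and the fibres of `p` are the orbits: `M' = M / G`.) -/
def IsPrincipalBundle (p : M → M') : Prop :=
  ContMDiff I I' ∞ p ∧
  ∀ x' : M', ∃ e : Bundle.Trivialization G p, x' ∈ e.baseSet ∧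
    ContMDiffOn I (I'.prod 𝓘(ℝ, F)) ∞ e e.source ∧
    ContMDiffOn (I'.prod 𝓘(ℝ, F)) I ∞ e.toOpenPartialHomeomorph.symm e.target ∧
    ∀ x ∈ e.source, ∀ g : G, g • x ∈ e.source ∧ e (g • x) = ((e x).1, g * (e x).2)

variable (G) in
/-- The action of `G` preserves the metric and the potential. -/
def NaturalSystem.IsSymmetric (S : NaturalSystem I M) : Prop :=
  ∀ (g : G) (x : M), S.potential (g • x) = S.potential x ∧
    ∀ w₁ w₂ : TangentSpace I x,
      S.metric.inner (g • x) (mfderiv I I (fun y : M => g • y) x w₁)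
        (mfderiv I I (fun y : M => g • y) x w₂) = S.metric.inner x w₁ w₂

variable (I M) in
/-- The generating vector field `v(x) = d/dτ|_{τ=0} g^τ(x)`. -/
def generator (φ : OneParameterGroup F G) (x : M) : TangentSpace I x :=
  mfderiv 𝓘(ℝ, ℝ) I (fun τ : ℝ => φ.g τ • x) 0 (1 : ℝ)

/-- The squared length `⟨v, v⟩` of the generating vector field. -/
def generatorNormSq (φ : OneParameterGroup F G) (m : Metric I M) (x : M) : ℝ :=
  m.inner x (generator I M φ x) (generator I M φ x)

/-- The momentum `J(w) = ⟨v, w⟩`. -/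
def momentum (φ : OneParameterGroup F G) (m : Metric I M) (w : TangentBundle I M) : ℝ :=
  m.inner w.proj (generator I M φ w.proj) w.snd

/-- The level set `J_k` of the momentum in `T(M)`. -/
def momentumLevel (φ : OneParameterGroup F G) (m : Metric I M) (k : ℝ) :
    Set (TangentBundle I M) :=
  {w | momentum φ m w = k}

/-- The form `η(w) = ⟨v, w⟩ / ⟨v, v⟩` of the connection whose horizontal subspaces are the fibres
of `J_0`; the Lie algebra of `G` is identified with `ℝ` through the given parametrization. -/
def connectionForm (φ : OneParameterGroup F G) (m : Metric I M) : Form I M 1 :=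
  Form.ofCovector I fun x =>
    (generatorNormSq φ m x)⁻¹ • m.inner x (generator I M φ x)

/-- The curvature form `γ = dη` of the connection `J_0`. -/
def curvatureForm (φ : OneParameterGroup F G) (m : Metric I M) : Form I M 2 :=
  Form.d I (connectionForm φ m)

/-- `m'` is the metric on the base induced by the horizontal distribution:
`m'(Tp(w₁), Tp(w₂)) = ⟨w₁, w₂⟩` for horizontal `w₁, w₂`, i.e. for `w₁, w₂ ∈ J_0(x)`. -/
def IsReducedMetric (φ : OneParameterGroup F G) (p : M → M') (m : Metric I M)
    (m' : Metric I' M') : Prop :=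
  ∀ (x : M) (w₁ w₂ : TangentSpace I x),
    (⟨x, w₁⟩ : TangentBundle I M) ∈ momentumLevel φ m 0 →
    (⟨x, w₂⟩ : TangentBundle I M) ∈ momentumLevel φ m 0 →
    m'.inner (p x) (mfderiv I I' p x w₁) (mfderiv I I' p x w₂) = m.inner x w₁ w₂

/-- `V'` is the amended potential: `V'(p(x)) = V(x) + k² / (2⟨v(x), v(x)⟩)`. -/
def IsAmendedPotential (φ : OneParameterGroup F G) (p : M → M') (S : NaturalSystem I M) (k : ℝ)
    (V' : M' → ℝ) : Prop :=
  ∀ x : M, V' (p x) = S.potential x + k ^ 2 / (2 * generatorNormSq φ S.metric x)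

variable (I') in
/-- `γ'` is the `2`-form on the base induced by the curvature form: `γ = p^* γ'`. -/
def IsReducedCurvature (φ : OneParameterGroup F G) (p : M → M') (m : Metric I M)
    (γ' : Form I' M' 2) : Prop :=
  curvatureForm φ m = Form.pullback I I' p γ'

/-- `X'` is the reduced system of the field `X` for the momentum value `k`:
`Tρ_k ∘ X = X' ∘ ρ_k` on `J_k`, where `ρ_k` is the restriction of `Tp` to `J_k`. -/
def IsReducedSystem (φ : OneParameterGroup F G) (p : M → M') (m : Metric I M) (k : ℝ)
    (X : FieldOnTM I M) (X' : FieldOnTM I' M') : Prop :=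
  ∀ w ∈ momentumLevel φ m k,
    mfderiv I.tangent I'.tangent (tangentMap I I' p) w (X w) = X' (tangentMap I I' p w)

end Reduction

end GyroReduction

end

/-!
The reduction is carried out upstairs, on `T(M)`, by comparing differential forms along the
projection `π : T(M) → J_k` that moves a tangent vector along the generating field `v` until its
momentum is `k` (`levelProjection`). Let `P = Tp`, and let primes denote the objects on `M'`.
Since `P ∘ π = P`, a direct computation with the orthogonal splitting of a tangent vector into its
vertical and horizontal components gives

* `π^* θ = P^* θ' + k p_M^* η` (`pullback_levelProjection_lagrangeOne`), and
* `H ∘ π = H' ∘ P`, where `H'` has the amended potential (`energy_levelProjection`).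

Applying `d` to the first identity, with `dη = γ = p^* γ'`, yields
`π^* σ = P^* (σ' + k p_{M'}^* γ')` (`pullback_levelProjection_lagrangeTwo`). The momentum is a first
integral (`momentum_conserved`), so on `J_k` the field `X` is tangent to `J_k` and `Tπ(X) = X`
(`mfderiv_levelProjection`). Pulling `i_X σ = -dH` back by `π` therefore shows that `TP(X)` solves
the equation that determines the dynamical system of `(M', m', V'_k, k γ')`, because `TP` is onto
(`mfderiv_tangentMap_surjective`). The form `σ' + k p_{M'}^* γ'` is nondegenerate
(`isNondegenerate_lagrangeTwo_add`), so `TP(X) = X' ∘ P` on `J_k`; as `P` maps `J_k` onto `T(M')`,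
this determines the reduced system.

The objects on `M'` are constructed with local sections `s` of `p`. The horizontal part of the
metric and the curvature form are `G`-invariant and vanish on `v`, which spans the kernel of `Tp`
(`exists_smul_generator`); hence their pullbacks by `s` do not depend on `s`. Both Noether's theorem
and the vanishing of `γ` on `v` are instances of Cartan's formula for a `1`-form invariant under a
flow (`Form.d_apply_of_invariant`). The calculus of forms rests on the naturality of the exterior
derivative (`Form.d_pullback`).

An equality between tangent vectors at points that are equal only propositionally is stated in the
model vector space, in the form `@Eq E a b`.
-/

set_option linter.unusedSectionVars false

namespace GyroReduction

/-! ### Smooth families of alternating maps -/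

section Alternating

variable {E : Type*} [NormedAddCommGroup E] [NormedSpace ℝ E]
  {E' : Type*} [NormedAddCommGroup E'] [NormedSpace ℝ E']
  {V : Type*} [NormedAddCommGroup V] [NormedSpace ℝ V]

theorem contDiffAt_of_comp_injective {W : Type*} [NormedAddCommGroup W] [NormedSpace ℝ W]
    [FiniteDimensional ℝ W] [FiniteDimensional ℝ V] (L : V →ₗ[ℝ] W)
    (hL : Function.Injective L) {f : E → V} {x : E} {n : ℕ∞ω}
    (h : ContDiffAt ℝ n (fun y => L (f y)) x) : ContDiffAt ℝ n f x := by
  obtain ⟨g, hg⟩ := L.exists_leftInverse_of_injective (LinearMap.ker_eq_bot.mpr hL)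
  have : f = fun y => LinearMap.toContinuousLinearMap g (L (f y)) := by
    funext y
    exact (LinearMap.congr_fun hg (f y)).symm
  rw [this]
  exact (LinearMap.toContinuousLinearMap g).contDiff.contDiffAt.comp x h

theorem finiteDimensional_alternating [FiniteDimensional ℝ E'] (n : ℕ) :
    FiniteDimensional ℝ (E' [⋀^Fin n]→L[ℝ] ℝ) := by
  let L : (E' [⋀^Fin n]→L[ℝ] ℝ) →ₗ[ℝ] MultilinearMap ℝ (fun _ : Fin n => E') ℝ :=
    { toFun := fun ξ => ξ.toMultilinearMap
      map_add' := fun _ _ => rfl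
      map_smul' := fun _ _ => rfl }
  refine FiniteDimensional.of_injective L fun a b h => ?_
  ext v
  exact congrArg (fun m : MultilinearMap ℝ (fun _ : Fin n => E') ℝ => m v) h

/-- A family of alternating maps on a finite-dimensional space is smooth as soon as all its
evaluations are. -/
theorem contDiffAt_alternating [FiniteDimensional ℝ E'] {n : ℕ} {r : ℕ∞ω}
    {f : E → E' [⋀^Fin n]→L[ℝ] ℝ} {x : E}
    (h : ∀ v : Fin n → E', ContDiffAt ℝ r (fun y => f y v) x) : ContDiffAt ℝ r f x := by
  have := finiteDimensional_alternating (E' := E') n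
  let b := Module.finBasis ℝ E'
  let L : (E' [⋀^Fin n]→L[ℝ] ℝ) →ₗ[ℝ]
      ((Fin n → Fin (Module.finrank ℝ E')) → ℝ) :=
    { toFun := fun ξ s => ξ fun i => b (s i)
      map_add' := fun _ _ => rfl
      map_smul' := fun _ _ => rfl }
  refine contDiffAt_of_comp_injective L (fun ξ ξ' hξ => ?_) (contDiffAt_pi.mpr fun s => h _)
  have : ξ.toMultilinearMap = ξ'.toMultilinearMap :=
    Module.Basis.ext_multilinear (fun _ => b) fun s => congrFun hξ s
  ext v
  exact congrArg (fun m : MultilinearMap ℝ (fun _ : Fin n => E') ℝ => m v) this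

theorem contDiffAt_compContinuousLinearMap [FiniteDimensional ℝ V] {n : ℕ} {r : ℕ∞ω}
    {ξ : E → E' [⋀^Fin n]→L[ℝ] ℝ} {A : E → V →L[ℝ] E'} {x : E}
    (hξ : ContDiffAt ℝ r ξ x) (hA : ContDiffAt ℝ r A x) :
    ContDiffAt ℝ r (fun y => (ξ y).compContinuousLinearMap (A y)) x := by
  refine contDiffAt_alternating fun v => ?_
  have h1 : ContDiffAt ℝ r (fun y =>
      ContinuousMultilinearMap.compContinuousLinearMapContinuousMultilinear ℝ
        (fun _ : Fin n => V) (fun _ : Fin n => E') ℝ (fun _ => A y)) x :=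
    (ContinuousMultilinearMap.contDiff _).contDiffAt.comp x (contDiffAt_pi.mpr fun _ => hA)
  have h2 : ContDiffAt ℝ r (fun y => (ξ y).toContinuousMultilinearMap) x :=
    (ContinuousAlternatingMap.toContinuousMultilinearMapLI (𝕜 := ℝ) (E := E') (F := ℝ)
      (ι := Fin n)).toContinuousLinearMap.contDiff.contDiffAt.comp x hξ
  have h3 := h1.clm_apply h2
  exact (ContinuousMultilinearMap.apply ℝ (fun _ : Fin n => V) ℝ v).contDiff.contDiffAt.comp x h3

theorem extDeriv_one_apply {ζ : E → E [⋀^Fin 1]→L[ℝ] ℝ} {x : E} (h : DifferentiableAt ℝ ζ x)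
    (a b : E) :
    extDeriv ζ x ![a, b] =
      fderiv ℝ (fun y => ζ y ![b]) x a - fderiv ℝ (fun y => ζ y ![a]) x b := by
  have h0 : (0 : Fin 2).removeNth ![a, b] = ![b] := by
    ext i; fin_cases i; rfl
  have h1 : (1 : Fin 2).removeNth ![a, b] = ![a] := by
    ext i; fin_cases i; rfl
  rw [extDeriv_apply h, Fin.sum_univ_two, h0, h1]
  simp [sub_eq_add_neg]

end Alternating

/-! ### Pullbacks of forms and the exterior derivative on manifolds without boundary -/

namespace Form

section

variable {E : Type*} [NormedAddCommGroup E] [NormedSpace ℝ E]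
  {H : Type*} [TopologicalSpace H] {I : ModelWithCorners ℝ E H}
  {M : Type*} [TopologicalSpace M] [ChartedSpace H M]
  {E' : Type*} [NormedAddCommGroup E'] [NormedSpace ℝ E']
  {H' : Type*} [TopologicalSpace H'] {I' : ModelWithCorners ℝ E' H'}
  {M' : Type*} [TopologicalSpace M'] [ChartedSpace H' M']
  {E'' : Type*} [NormedAddCommGroup E''] [NormedSpace ℝ E'']
  {H'' : Type*} [TopologicalSpace H''] {I'' : ModelWithCorners ℝ E'' H''}
  {M'' : Type*} [TopologicalSpace M''] [ChartedSpace H'' M'']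
  {n : ℕ}

theorem pullback_apply (f : M → M') (ξ : Form I' M' n) (x : M) (v : Fin n → TangentSpace I x) :
    pullback I I' f ξ x v = ξ (f x) (fun i => mfderiv I I' f x (v i)) := rfl

theorem pullback_apply_one (f : M → M') (ξ : Form I' M' 1) (x : M) (a : TangentSpace I x) :
    pullback I I' f ξ x ![a] = ξ (f x) ![mfderiv I I' f x a] :=
  congrArg (ξ (f x)) (funext fun i => by fin_cases i; rfl)

theorem pullback_apply_two (f : M → M') (ξ : Form I' M' 2) (x : M) (a b : TangentSpace I x) :
    pullback I I' f ξ x ![a, b] = ξ (f x) ![mfderiv I I' f x a, mfderiv I I' f x b] :=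
  congrArg (ξ (f x)) (funext fun i => by fin_cases i <;> rfl)

theorem pullback_congr {f g : M → M'} (ξ : Form I' M' n) {x : M} (h : f =ᶠ[𝓝 x] g) :
    pullback I I' f ξ x = pullback I I' g ξ x := by
  have hx : f x = g x := h.self_of_nhds
  have hd : (mfderiv I I' f x : E →L[ℝ] E') = mfderiv I I' g x := h.mfderiv_eq
  let ξ' : M' → E' [⋀^Fin n]→L[ℝ] ℝ := ξ
  change (ξ' (f x)).compContinuousLinearMap (mfderiv I I' f x : E →L[ℝ] E') =
    (ξ' (g x)).compContinuousLinearMap (mfderiv I I' g x : E →L[ℝ] E')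
  rw [hx, hd]

theorem pullback_comp {g : M' → M''} {f : M → M'} (ξ : Form I'' M'' n) {x : M}
    (hg : MDifferentiableAt I' I'' g (f x)) (hf : MDifferentiableAt I I' f x) :
    pullback I I'' (g ∘ f) ξ x = pullback I I' f (pullback I' I'' g ξ) x := by
  ext v
  simp only [pullback_apply, mfderiv_comp x hg hf]
  rfl

theorem pullback_id (ξ : Form I M n) : pullback I I id ξ = ξ := by
  funext x
  ext v
  rw [pullback_apply, mfderiv_id]
  rfl

section Boundaryless

variable [I.Boundaryless] [I'.Boundaryless]

theorem inChart_eq_pullback (ξ : Form I M n) (x₀ : M) :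
    inChart I ξ x₀ = pullback 𝓘(ℝ, E) I (extChartAt I x₀).symm ξ := by
  funext y
  have h : mfderivWithin 𝓘(ℝ, E) I (extChartAt I x₀).symm (range I) y =
      mfderiv 𝓘(ℝ, E) I (extChartAt I x₀).symm y := by
    rw [I.range_eq_univ, mfderivWithin_univ]
  exact congrArg (fun A => (ξ ((extChartAt I x₀).symm y)).compContinuousLinearMap A) h

theorem d_eq_extDeriv (ξ : Form I M n) [IsManifold I 1 M] (x : M) :
    d I ξ x = extDeriv (inChart I ξ x) (extChartAt I x x) := by
  have h : d I ξ x = (extDerivWithin (inChart I ξ x) (range I)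
      (extChartAt I x x)).compContinuousLinearMap (ContinuousLinearMap.id ℝ E) :=
    congrArg (fun A => (extDerivWithin (inChart I ξ x) (range I)
      (extChartAt I x x)).compContinuousLinearMap A) mfderiv_extChartAt_self
  rw [h, I.range_eq_univ, extDerivWithin_univ]
  rfl

theorem contDiffAt_written {f : M → M'} {x : M} {r : ℕ∞ω} (hf : ContMDiffAt I I' r f x) :
    ContDiffAt ℝ r (extChartAt I' (f x) ∘ f ∘ (extChartAt I x).symm) (extChartAt I x x) := by
  have h := (contMDiffAt_iff.mp hf).2
  rwa [I.range_eq_univ, contDiffWithinAt_univ] at h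

variable [IsManifold I ∞ M] [IsManifold I' ∞ M']

theorem contMDiffAt_extChartAt_symm {x₀ : M} {y : E} (hy : y ∈ (extChartAt I x₀).target) :
    ContMDiffAt 𝓘(ℝ, E) I ∞ (extChartAt I x₀).symm y :=
  (contMDiffOn_extChartAt_symm x₀).contMDiffAt ((isOpen_extChartAt_target x₀).mem_nhds hy)

/-- In charts, the pullback of a form is the pullback by the expression of the map in charts. -/
theorem inChart_pullback {f : M → M'} {x : M} (ξ : Form I' M' n) (hf : ContMDiffAt I I' 1 f x) :
    inChart I (pullback I I' f ξ) x =ᶠ[𝓝 (extChartAt I x x)] fun y =>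
      (inChart I' ξ (f x) ((extChartAt I' (f x) ∘ f ∘ (extChartAt I x).symm) y))
        |>.compContinuousLinearMap
          (fderiv ℝ (extChartAt I' (f x) ∘ f ∘ (extChartAt I x).symm) y) := by
  set F := extChartAt I' (f x) ∘ f ∘ (extChartAt I x).symm with hF
  have hcont : ContinuousAt (extChartAt I x).symm (extChartAt I x x) :=
    continuousAt_extChartAt_symm x
  have hx : (extChartAt I x).symm (extChartAt I x x) = x := extChartAt_to_inv x
  have hd : ∀ᶠ y in 𝓝 (extChartAt I x x), MDifferentiableAt I I' f ((extChartAt I x).symm y) := by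
    have h1 : ∀ᶠ z in 𝓝 ((extChartAt I x).symm (extChartAt I x x)),
        MDifferentiableAt I I' f z := by
      rw [hx]
      exact ((contMDiffAt_iff_contMDiffAt_nhds (by simp)).mp hf).mono fun z hz =>
        hz.mdifferentiableAt one_ne_zero
    exact hcont.eventually h1
  have ht : ∀ᶠ y in 𝓝 (extChartAt I x x), y ∈ (extChartAt I x).target :=
    (isOpen_extChartAt_target x).mem_nhds (mem_extChartAt_target x)
  have hs : ∀ᶠ y in 𝓝 (extChartAt I x x),
      f ((extChartAt I x).symm y) ∈ (extChartAt I' (f x)).source := by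
    have h1 : ∀ᶠ z in 𝓝 ((extChartAt I x).symm (extChartAt I x x)),
        f z ∈ (extChartAt I' (f x)).source := by
      rw [hx]
      exact hf.continuousAt.eventually
        ((isOpen_extChartAt_source (f x)).mem_nhds (mem_extChartAt_source (f x)))
    exact hcont.eventually h1
  have hFd : ∀ᶠ y in 𝓝 (extChartAt I x x), DifferentiableAt ℝ F y :=
    ((contDiffAt_written hf).eventually (by simp)).mono fun y hy =>
      hy.differentiableAt one_ne_zero
  filter_upwards [hd, ht, hFd, hs, hs.eventually_nhds] with y hdy hty hFy hsy hsn
  have hχ : MDifferentiableAt 𝓘(ℝ, E) I (extChartAt I x).symm y :=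
    (contMDiffAt_extChartAt_symm hty).mdifferentiableAt (by simp)
  have hFt : F y ∈ (extChartAt I' (f x)).target := (extChartAt I' (f x)).map_source hsy
  have hχ' : MDifferentiableAt 𝓘(ℝ, E') I' (extChartAt I' (f x)).symm (F y) :=
    (contMDiffAt_extChartAt_symm hFt).mdifferentiableAt (by simp)
  have heq : f ∘ (extChartAt I x).symm =ᶠ[𝓝 y] (extChartAt I' (f x)).symm ∘ F :=
    hsn.mono fun z hz => ((extChartAt I' (f x)).left_inv hz).symm
  rw [inChart_eq_pullback, ← pullback_comp ξ hdy hχ, pullback_congr ξ heq,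
    pullback_comp ξ hχ' hFy.mdifferentiableAt, ← inChart_eq_pullback]
  have h : mfderiv 𝓘(ℝ, E) 𝓘(ℝ, E') F y = fderiv ℝ F y := mfderiv_eq_fderiv
  exact congrArg (fun A => (inChart I' ξ (f x) (F y)).compContinuousLinearMap A) h

/-- Smoothness of a form at a point, read in the preferred chart at that point. By `isSmooth_iff`,
the choice of the chart is immaterial. -/
def SmoothAt (I : ModelWithCorners ℝ E H) (ξ : Form I M n) (x : M) : Prop :=
  ContDiffAt ℝ ∞ (inChart I ξ x) (extChartAt I x x)

theorem SmoothAt.pullback [FiniteDimensional ℝ E] {f : M → M'} {x : M} {ξ : Form I' M' n}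
    (hξ : SmoothAt I' ξ (f x)) (hf : ContMDiffAt I I' ∞ f x) :
    SmoothAt I (Form.pullback I I' f ξ) x := by
  have hF := contDiffAt_written hf
  refine ContDiffAt.congr_of_eventuallyEq ?_ (inChart_pullback ξ (hf.of_le (by simp)))
  refine contDiffAt_compContinuousLinearMap (ContDiffAt.comp (g := inChart I' ξ (f x)) _ ?_ hF)
    (hF.fderiv_right (m := ∞) (by simp))
  have hFx : (extChartAt I' (f x) ∘ f ∘ (extChartAt I x).symm) (extChartAt I x x) =
      extChartAt I' (f x) (f x) := by simp
  rw [hFx]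
  exact hξ

/-- The exterior derivative commutes with pullbacks. -/
theorem d_pullback {f : M → M'} {x : M} {ξ : Form I' M' n}
    (hξ : SmoothAt I' ξ (f x)) (hf : ContMDiffAt I I' ∞ f x) :
    d I (Form.pullback I I' f ξ) x = Form.pullback I I' f (d I' ξ) x := by
  have : IsManifold I 1 M := IsManifold.of_le (n := ∞) (by simp)
  have : IsManifold I' 1 M' := IsManifold.of_le (n := ∞) (by simp)
  have hF := contDiffAt_written hf
  have hFx : (extChartAt I' (f x) ∘ f ∘ (extChartAt I x).symm) (extChartAt I x x) =
      extChartAt I' (f x) (f x) := by simp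
  have hD : (mfderiv I I' f x : E →L[ℝ] E') =
      fderiv ℝ (extChartAt I' (f x) ∘ f ∘ (extChartAt I x).symm) (extChartAt I x x) := by
    refine (hf.mdifferentiableAt (by simp)).mfderiv.trans ?_
    rw [I.range_eq_univ, fderivWithin_univ]
    rfl
  have h1 : d I (Form.pullback I I' f ξ) x = _ := d_eq_extDeriv _ x
  rw [h1, (inChart_pullback ξ (hf.of_le (by simp))).extDeriv_eq,
    extDeriv_pullback (r := ∞) (by rw [hFx]; exact ContDiffAt.differentiableAt hξ (by simp)) hF
      (by simpa using ENat.LEInfty.out), hFx, ← hD]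
  exact congrArg (fun A : E' [⋀^Fin (n + 1)]→L[ℝ] ℝ =>
    A.compContinuousLinearMap (mfderiv I I' f x : E →L[ℝ] E')) (d_eq_extDeriv ξ (f x)).symm

theorem inChart_congr {ξ ζ : Form I M n} {x : M} (h : ∀ᶠ y in 𝓝 x, ξ y = ζ y) :
    inChart I ξ x =ᶠ[𝓝 (extChartAt I x x)] inChart I ζ x := by
  have hx : (extChartAt I x).symm (extChartAt I x x) = x := extChartAt_to_inv x
  rw [← hx] at h
  filter_upwards [(continuousAt_extChartAt_symm x).eventually h] with y hy
  unfold inChart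
  rw [hy]

theorem SmoothAt.congr {ξ ζ : Form I M n} {x : M} (hξ : SmoothAt I ξ x)
    (h : ∀ᶠ y in 𝓝 x, ξ y = ζ y) : SmoothAt I ζ x :=
  ContDiffAt.congr_of_eventuallyEq hξ (inChart_congr (h.mono fun _ hy => hy.symm))

theorem d_congr {ξ ζ : Form I M n} {x : M} (h : ∀ᶠ y in 𝓝 x, ξ y = ζ y) :
    d I ξ x = d I ζ x := by
  unfold d
  rw [(inChart_congr h).extDerivWithin_eq_nhds]

theorem smoothAt_vectorSpace {ξ : Form 𝓘(ℝ, E) E n} {y : E} :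
    SmoothAt 𝓘(ℝ, E) ξ y ↔ ContDiffAt (F := E [⋀^Fin n]→L[ℝ] ℝ) ℝ ∞ ξ y := by
  have h : inChart 𝓘(ℝ, E) ξ y = ξ := by
    rw [inChart_eq_pullback, extChartAt_model_space_eq_id]
    exact pullback_id ξ
  unfold SmoothAt
  rw [h, extChartAt_model_space_eq_id]
  rfl

theorem d_vectorSpace (ξ : Form 𝓘(ℝ, E) E n) (y : E) :
    d 𝓘(ℝ, E) ξ y = extDeriv (E := E) ξ y := by
  have h : inChart 𝓘(ℝ, E) ξ y = ξ := by
    rw [inChart_eq_pullback, extChartAt_model_space_eq_id]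
    exact pullback_id ξ
  rw [d_eq_extDeriv, h, extChartAt_model_space_eq_id]
  rfl

theorem isSmooth_iff [FiniteDimensional ℝ E] {ξ : Form I M n} :
    IsSmooth I ξ ↔ ∀ x, SmoothAt I ξ x := by
  constructor
  · intro h x
    exact (h x).contDiffAt ((isOpen_extChartAt_target x).mem_nhds (mem_extChartAt_target x))
  · intro h x₀ y hy
    refine ContDiffAt.contDiffWithinAt ?_
    rw [inChart_eq_pullback]
    exact smoothAt_vectorSpace.mp ((h _).pullback (contMDiffAt_extChartAt_symm hy))

theorem inChart_d [FiniteDimensional ℝ E] {ξ : Form I M n} (hξ : IsSmooth I ξ) (x : M) {y : E}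
    (hy : y ∈ (extChartAt I x).target) :
    inChart I (d I ξ) x y = extDeriv (inChart I ξ x) y := by
  rw [inChart_eq_pullback, ← d_pullback (isSmooth_iff.mp hξ _) (contMDiffAt_extChartAt_symm hy),
    d_vectorSpace, inChart_eq_pullback]

theorem IsSmooth.d [FiniteDimensional ℝ E] {ξ : Form I M n} (hξ : IsSmooth I ξ) :
    IsSmooth I (Form.d I ξ) := by
  rw [isSmooth_iff]
  intro x
  have ht := (isOpen_extChartAt_target (I := I) x).mem_nhds (mem_extChartAt_target x)
  refine ContDiffAt.congr_of_eventuallyEq ?_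
    (Filter.eventually_of_mem ht fun y hy => inChart_d hξ x hy)
  have h1 : ContDiffAt ℝ ∞ (fderiv ℝ (inChart I ξ x)) (extChartAt I x x) :=
    ContDiffAt.fderiv_right (n := ∞) (isSmooth_iff.mp hξ x) (by simp)
  exact (ContinuousAlternatingMap.alternatizeUncurryFinCLM ℝ E ℝ).contDiff.contDiffAt.comp _ h1

theorem d_d [FiniteDimensional ℝ E] {ξ : Form I M n} (hξ : IsSmooth I ξ) :
    Form.d I (Form.d I ξ) = 0 := by
  have : IsManifold I 1 M := IsManifold.of_le (n := ∞) (by simp)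
  funext x
  have ht := (isOpen_extChartAt_target (I := I) x).mem_nhds (mem_extChartAt_target x)
  have he : inChart I (Form.d I ξ) x =ᶠ[𝓝 (extChartAt I x x)] extDeriv (inChart I ξ x) :=
    Filter.eventually_of_mem ht fun y hy => inChart_d hξ x hy
  have h1 := d_eq_extDeriv (Form.d I ξ) x
  rw [h1, he.extDeriv_eq, extDeriv_extDeriv_apply (r := ∞) (isSmooth_iff.mp hξ x)
    (by simpa using ENat.LEInfty.out)]
  rfl

theorem SmoothAt.add {ξ ζ : Form I M n} {x : M} (hξ : SmoothAt I ξ x) (hζ : SmoothAt I ζ x) :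
    SmoothAt I (ξ + ζ) x :=
  ContDiffAt.add hξ hζ

theorem SmoothAt.smul (c : ℝ) {ξ : Form I M n} {x : M} (hξ : SmoothAt I ξ x) :
    SmoothAt I (c • ξ) x :=
  ContDiffAt.const_smul c hξ

theorem d_add {ξ ζ : Form I M n} {x : M} (hξ : SmoothAt I ξ x) (hζ : SmoothAt I ζ x) :
    Form.d I (ξ + ζ) x = Form.d I ξ x + Form.d I ζ x := by
  have : IsManifold I 1 M := IsManifold.of_le (n := ∞) (by simp)
  have h1 := d_eq_extDeriv (ξ + ζ) x
  have h2 := d_eq_extDeriv ξ x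
  have h3 := d_eq_extDeriv ζ x
  rw [h1, h2, h3]
  exact extDeriv_add (ContDiffAt.differentiableAt hξ (by simp))
    (ContDiffAt.differentiableAt hζ (by simp))

theorem d_smul (c : ℝ) (ξ : Form I M n) (x : M) :
    Form.d I (c • ξ) x = c • Form.d I ξ x := by
  have : IsManifold I 1 M := IsManifold.of_le (n := ∞) (by simp)
  have h1 := d_eq_extDeriv (c • ξ) x
  have h2 := d_eq_extDeriv ξ x
  rw [h1, h2]
  exact extDeriv_smul (E := E) c (inChart I ξ x)

/-- The vector field with smooth components `u` in the trivialization of the tangent bundle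
at `x` is smooth at `x`. -/
theorem contMDiffAt_coordField {x : M} {u : M → E} (hu : ContMDiffAt I 𝓘(ℝ, E) ∞ u x) :
    ContMDiffAt I I.tangent ∞ (fun y =>
      (⟨y, (trivializationAt E (TangentSpace I : M → Type _) x).symm y (u y)⟩ :
        TangentBundle I M)) x := by
  set e := trivializationAt E (TangentSpace I : M → Type _) x
  have h1 : ContMDiffAt I (I.prod 𝓘(ℝ, E)) ∞ (fun y : M => (y, u y)) x :=
    contMDiffAt_id.prodMk hu
  have hx : x ∈ e.baseSet := mem_baseSet_trivializationAt E _ x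
  have h2 : ContMDiffAt (I.prod 𝓘(ℝ, E)) I.tangent ∞ e.toOpenPartialHomeomorph.symm (x, u x) :=
    e.contMDiffOn_symm.contMDiffAt (e.open_target.mem_nhds (e.mem_target.mpr hx))
  refine (h2.comp x h1).congr_of_eventuallyEq ?_
  filter_upwards [e.open_baseSet.mem_nhds hx] with y hy
  exact e.mk_symm hy (u y)

/-- A form is smooth at a point as soon as its values on smooth vector fields are. -/
theorem smoothAt_of_apply [FiniteDimensional ℝ E] {ξ : Form I M n} {x : M}
    (h : ∀ V : Fin n → (y : M) → TangentSpace I y,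
      (∀ i, ContMDiffAt I I.tangent ∞ (fun y => (⟨y, V i y⟩ : TangentBundle I M)) x) →
      ContMDiffAt I 𝓘(ℝ, ℝ) ∞ (fun y => ξ y fun i => V i y) x) : SmoothAt I ξ x := by
  have : IsManifold I 1 M := IsManifold.of_le (n := ∞) (by simp)
  refine contDiffAt_alternating fun v => ?_
  have hx : (extChartAt I x).symm (extChartAt I x x) = x := extChartAt_to_inv x
  have h1 := h _ fun i => contMDiffAt_coordField (u := fun _ => v i) contMDiffAt_const
  have h2 := (ContMDiffAt.comp_of_eq h1
    (contMDiffAt_extChartAt_symm (mem_extChartAt_target x)) hx).contDiffAt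
  refine h2.congr_of_eventuallyEq ?_
  filter_upwards [(isOpen_extChartAt_target (I := I) x).mem_nhds (mem_extChartAt_target x)]
    with y hy
  have hy' : (extChartAt I x).symm y ∈ (chartAt H x).source := by
    simpa using (extChartAt I x).map_target hy
  have h3 := TangentBundle.symmL_trivializationAt (I := I) hy'
  rw [(extChartAt I x).right_inv hy] at h3
  refine congrArg (ξ ((extChartAt I x).symm y)) (funext fun i => ?_)
  exact (DFunLike.congr_fun h3 (v i)).symm.trans
    (Bundle.Trivialization.symmL_apply (R := ℝ) _ hy' (v i))

end Boundaryless

end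

end Form

end GyroReduction

namespace GyroReduction

/-! ### Cartan's formula for invariant `1`-forms -/

namespace Form

section

variable {E : Type*} [NormedAddCommGroup E] [NormedSpace ℝ E]
  {H : Type*} [TopologicalSpace H] {I : ModelWithCorners ℝ E H}
  {M : Type*} [TopologicalSpace M] [ChartedSpace H M]
  {V : Type*} [NormedAddCommGroup V] [NormedSpace ℝ V]
  {W : Type*} [NormedAddCommGroup W] [NormedSpace ℝ W]

theorem mfderiv_comp_hasFDerivAt {g : W → M} {c : V → W} {c' : V →L[ℝ] W} {t : V}
    (hg : MDifferentiableAt 𝓘(ℝ, W) I g (c t)) (hc : HasFDerivAt c c' t) (a : V) :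
    mfderiv 𝓘(ℝ, V) I (fun s => g (c s)) t a = mfderiv 𝓘(ℝ, W) I g (c t) (c' a) := by
  have h := mfderiv_comp_apply (I := 𝓘(ℝ, V)) (I' := 𝓘(ℝ, W)) (I'' := I) t hg
    hc.differentiableAt.mdifferentiableAt a
  have h2 : mfderiv 𝓘(ℝ, V) 𝓘(ℝ, W) c t = c' := by rw [mfderiv_eq_fderiv, hc.fderiv]
  rw [h2] at h
  exact h

variable [I.Boundaryless] [IsManifold I ∞ M] [FiniteDimensional ℝ E]

/-- Cartan's formula for an invariant `1`-form: if the flow `Φ` with generating field `Z`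
preserves the `1`-form `α`, then `i_Z dα = -d(α(Z))`. -/
theorem d_apply_of_invariant {Φ : ℝ → M → M}
    (hΦ : ContMDiff (𝓘(ℝ, ℝ).prod I) I ∞ fun q : ℝ × M => Φ q.1 q.2) (h0 : ∀ x, Φ 0 x = x)
    {α : Form I M 1} (hα : IsSmooth I α) (hinv : ∀ τ, pullback I I (Φ τ) α = α)
    {j : M → ℝ} (hj : ∀ τ x,
      α (Φ τ x) ![mfderiv 𝓘(ℝ, ℝ) I (fun t => Φ t x) τ (1 : ℝ)] = j x)
    {x : M} (hjx : MDifferentiableAt I 𝓘(ℝ, ℝ) j x) {Z : TangentSpace I x}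
    (hZ : @Eq E Z (mfderiv 𝓘(ℝ, ℝ) I (fun t => Φ t x) 0 (1 : ℝ))) (Y : TangentSpace I x) :
    d I α x ![Z, Y] = -mfderiv I 𝓘(ℝ, ℝ) j x Y := by
  have : IsManifold I 1 M := IsManifold.of_le (n := ∞) (by simp)
  set χ := extChartAt I x with hχ
  have hx : χ.symm (χ x) = x := extChartAt_to_inv x
  -- pull `α` back to the product of the time axis and the chart domain
  let f : ℝ × E → M := fun q => Φ q.1 (χ.symm q.2)
  have hf : ∀ q : ℝ × E, q.2 ∈ χ.target → ContMDiffAt 𝓘(ℝ, ℝ × E) I ∞ f q := by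
    intro q hq
    have h2 : ContMDiffAt 𝓘(ℝ, ℝ × E) (𝓘(ℝ, ℝ).prod I) ∞
        (fun q : ℝ × E => (q.1, χ.symm q.2)) q :=
      contDiff_fst.contMDiff.contMDiffAt.prodMk
        ((contMDiffAt_extChartAt_symm hq).comp q contDiff_snd.contMDiff.contMDiffAt)
    exact hΦ.contMDiffAt.comp q h2
  have hxt : χ x ∈ χ.target := mem_extChartAt_target x
  let ζ : Form 𝓘(ℝ, ℝ × E) (ℝ × E) 1 := pullback 𝓘(ℝ, ℝ × E) I f α
  let ζ' : ℝ × E → (ℝ × E) [⋀^Fin 1]→L[ℝ] ℝ := ζ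
  have hζ : SmoothAt 𝓘(ℝ, ℝ × E) ζ (0, χ x) :=
    (isSmooth_iff.mp hα _).pullback (hf (0, χ x) hxt)
  have hζd := d_pullback (isSmooth_iff.mp hα _) (hf (0, χ x) hxt)
  have hfd : ∀ q : ℝ × E, q.2 ∈ χ.target → MDifferentiableAt 𝓘(ℝ, ℝ × E) I f q :=
    fun q hq => (hf q hq).mdifferentiableAt (by simp)
  have hχd : ∀ y ∈ χ.target, MDifferentiableAt 𝓘(ℝ, E) I χ.symm y :=
    fun y hy => (contMDiffAt_extChartAt_symm hy).mdifferentiableAt (by simp)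
  have hΦd : ∀ τ, MDifferentiable I I (Φ τ) := fun τ =>
    (hΦ.comp (contMDiff_const.prodMk contMDiff_id)).mdifferentiable (by simp)
  have hfτ : ∀ (τ : ℝ) (y : E), y ∈ χ.target →
      mfderiv 𝓘(ℝ, ℝ × E) I f (τ, y) ((1 : ℝ), (0 : E)) =
        mfderiv 𝓘(ℝ, ℝ) I (fun t => Φ t (χ.symm y)) τ (1 : ℝ) := fun τ y hy =>
    (mfderiv_comp_hasFDerivAt (g := f) (c := fun t => (t, y)) (hfd (τ, y) hy)
      (hasFDerivAt_prodMk_left τ y) 1).symm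
  have hfY : ∀ (τ : ℝ) (y : E), y ∈ χ.target → ∀ b : E,
      mfderiv 𝓘(ℝ, ℝ × E) I f (τ, y) ((0 : ℝ), b) =
        mfderiv 𝓘(ℝ, E) I (fun y => Φ τ (χ.symm y)) y b := fun τ y hy b =>
    (mfderiv_comp_hasFDerivAt (g := f) (c := fun y => (τ, y)) (hfd (τ, y) hy)
      (hasFDerivAt_prodMk_right τ y) b).symm
  have hζτ : ∀ (τ : ℝ) (y : E), y ∈ χ.target →
      ζ' (τ, y) ![((1 : ℝ), (0 : E))] = j (χ.symm y) := by
    intro τ y hy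
    rw [← hj τ (χ.symm y)]
    refine (pullback_apply_one _ _ _ _).trans ?_
    rw [hfτ τ y hy]
  have hζY : ∀ (τ : ℝ) (y : E), y ∈ χ.target → ∀ b : E,
      ζ' (τ, y) ![((0 : ℝ), b)] = inChart I α x y ![b] := by
    intro τ y hy b
    refine (pullback_apply_one _ _ _ _).trans ?_
    rw [hfY τ y hy, inChart_eq_pullback]
    have h1 := pullback_comp α (hΦd τ (χ.symm y)) (hχd y hy)
    rw [hinv τ] at h1
    rw [← h1]
    exact (pullback_apply_one (Φ τ ∘ χ.symm) α y b).symm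
  -- the coefficients of `ζ` do not depend on the time, so only `j` contributes to `dζ`
  have hdζ : d 𝓘(ℝ, ℝ × E) ζ (0, χ x) ![((1 : ℝ), (0 : E)), ((0 : ℝ), Y)] =
      -mfderiv I 𝓘(ℝ, ℝ) j x Y := by
    have hζ' : DifferentiableAt ℝ ζ' (0, χ x) :=
      ContDiffAt.differentiableAt (smoothAt_vectorSpace.mp hζ) (by simp)
    refine (DFunLike.congr_fun (d_vectorSpace ζ (0, χ x)) _).trans ?_
    refine (extDeriv_one_apply hζ' _ _).trans ?_
    have ht : ∀ᶠ q : ℝ × E in 𝓝 (0, χ x), q.2 ∈ χ.target :=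
      continuous_snd.continuousAt.eventually ((isOpen_extChartAt_target x).mem_nhds hxt)
    have e1 : (fun q => ζ' q ![((0 : ℝ), Y)]) =ᶠ[𝓝 (0, χ x)]
        fun q => inChart I α x q.2 ![Y] := ht.mono fun q hq => hζY q.1 q.2 hq Y
    have e2 : (fun q => ζ' q ![((1 : ℝ), (0 : E))]) =ᶠ[𝓝 (0, χ x)]
        fun q => j (χ.symm q.2) := ht.mono fun q hq => hζτ q.1 q.2 hq
    have hα1 : DifferentiableAt ℝ (fun y => inChart I α x y ![Y]) (χ x) :=
      (ContDiffAt.differentiableAt (isSmooth_iff.mp hα x)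
        (by simp)).continuousAlternatingMap_apply_const _
    have hj1 : MDifferentiableAt 𝓘(ℝ, E) 𝓘(ℝ, ℝ) (j ∘ χ.symm) (χ x) := by
      refine MDifferentiableAt.comp_of_eq (χ x) hjx (hχd _ hxt) hx
    have d1 : HasFDerivAt (fun q : ℝ × E => inChart I α x q.2 ![Y]) _ (0, χ x) :=
      HasFDerivAt.comp (g := fun y => inChart I α x y ![Y]) (f := Prod.snd) (0, χ x)
        hα1.hasFDerivAt hasFDerivAt_snd
    have d2 : HasFDerivAt (fun q : ℝ × E => j (χ.symm q.2)) _ (0, χ x) :=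
      HasFDerivAt.comp (g := j ∘ χ.symm) (f := Prod.snd) (0, χ x)
        hj1.differentiableAt.hasFDerivAt hasFDerivAt_snd
    have d3 : fderiv ℝ (j ∘ χ.symm) (χ x) Y = mfderiv I 𝓘(ℝ, ℝ) j x Y := by
      rw [← mfderiv_eq_fderiv]
      refine (mfderiv_comp_apply_of_eq (χ x) hjx (hχd _ hxt) hx Y).trans ?_
      have := mfderivWithin_range_extChartAt_symm (I := I) (x := x)
      rw [I.range_eq_univ, mfderivWithin_univ] at this
      exact congrArg (mfderiv I 𝓘(ℝ, ℝ) j x) (DFunLike.congr_fun this Y)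
    rw [e1.fderiv_eq, e2.fderiv_eq, d1.fderiv, d2.fderiv]
    simp only [ContinuousLinearMap.comp_apply, ContinuousLinearMap.coe_snd', map_zero, d3]
    exact zero_sub _
  rw [← hdζ]
  refine Eq.trans ?_ (DFunLike.congr_fun hζd _).symm
  refine Eq.trans ?_ (pullback_apply_two f (d I α) (0, χ x) _ _).symm
  have hfx : f (0, χ x) = x := (h0 _).trans hx
  have hY : @Eq E (mfderiv 𝓘(ℝ, ℝ × E) I f (0, χ x) ((0 : ℝ), (Y : E))) Y := by
    have h1 : (fun y => Φ 0 (χ.symm y)) = χ.symm := funext fun y => h0 _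
    have h2 := mfderivWithin_range_extChartAt_symm (I := I) (x := x)
    rw [I.range_eq_univ, mfderivWithin_univ] at h2
    refine (hfY 0 (χ x) hxt Y).trans ?_
    rw [h1]
    exact DFunLike.congr_fun h2 Y
  have hZ' : @Eq E (mfderiv 𝓘(ℝ, ℝ × E) I f (0, χ x) ((1 : ℝ), (0 : E))) Z := by
    refine (hfτ 0 (χ x) hxt).trans ?_
    rw [hx]
    exact hZ.symm
  let ξ : M → E [⋀^Fin 2]→L[ℝ] ℝ := d I α
  change ξ x ![Z, Y] = ξ (f (0, χ x)) ![_, _]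
  rw [hfx]
  exact congrArg (ξ x) (congrArg₂ (fun a b : E => ![a, b]) hZ'.symm hY.symm)

end

end Form

end GyroReduction

namespace GyroReduction

/-! ### Vector fields determined by a nondegenerate `2`-form -/

section Musical

variable {E : Type*} [NormedAddCommGroup E] [NormedSpace ℝ E]

theorem alternating_two_swap {V : Type*} [AddCommGroup V] [Module ℝ V] [TopologicalSpace V]
    (ζ : V [⋀^Fin 2]→L[ℝ] ℝ) (a b : V) : ζ ![a, b] = -ζ ![b, a] := by
  refine Eq.trans ?_ (ζ.toAlternatingMap.map_swap ![b, a] (show (0 : Fin 2) ≠ 1 by decide))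
  refine congrArg ζ (funext fun i => ?_)
  fin_cases i <;> simp

/-- The linear map `a ↦ i_a ζ` of an alternating form of degree two. -/
noncomputable def flat (ζ : E [⋀^Fin 2]→L[ℝ] ℝ) : E →L[ℝ] E [⋀^Fin 1]→L[ℝ] ℝ := ζ.curryLeft

theorem flat_apply (ζ : E [⋀^Fin 2]→L[ℝ] ℝ) (a b : E) : flat ζ a ![b] = ζ ![a, b] := rfl

theorem contDiff_flat :
    ContDiff ℝ ∞ (flat : (E [⋀^Fin 2]→L[ℝ] ℝ) → E →L[ℝ] E [⋀^Fin 1]→L[ℝ] ℝ) := by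
  have h : IsBoundedLinearMap ℝ
      (flat : (E [⋀^Fin 2]→L[ℝ] ℝ) → E →L[ℝ] E [⋀^Fin 1]→L[ℝ] ℝ) :=
    IsLinearMap.with_bound ⟨fun _ _ => rfl, fun _ _ => rfl⟩ 1 fun x => by
      rw [one_mul]
      exact x.norm_curryLeft.le
  exact h.contDiff

theorem flat_bijective [FiniteDimensional ℝ E] {ζ : E [⋀^Fin 2]→L[ℝ] ℝ}
    (h : ∀ a, (∀ b, ζ ![a, b] = 0) → a = 0) : Function.Bijective (flat ζ) := by
  have hinj : Function.Injective (flat ζ) := by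
    refine (injective_iff_map_eq_zero (flat ζ)).mpr fun a ha => h a fun b => ?_
    rw [← flat_apply, ha]
    rfl
  let L : (E →L[ℝ] ℝ) ≃ₗ[ℝ] (E [⋀^Fin 1]→L[ℝ] ℝ) :=
    (ContinuousAlternatingMap.ofSubsingletonLIE (𝕜 := ℝ) (E := E) (F := ℝ)
      (0 : Fin 1)).toLinearEquiv
  have := finiteDimensional_alternating (E' := E) 1
  have hfin : Module.finrank ℝ E = Module.finrank ℝ (E [⋀^Fin 1]→L[ℝ] ℝ) := by
    rw [← L.finrank_eq, ← (LinearMap.toContinuousLinearMap (𝕜 := ℝ) (E := E) (F' := ℝ)).finrank_eq]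
    exact (Subspace.dual_finrank_eq (K := ℝ) (V := E)).symm
  exact ⟨hinj, (LinearMap.injective_iff_surjective_of_finrank_eq_finrank (f := (flat ζ).toLinearMap)
    hfin).mp hinj⟩

theorem flat_isInvertible [FiniteDimensional ℝ E] {ζ : E [⋀^Fin 2]→L[ℝ] ℝ}
    (h : ∀ a, (∀ b, ζ ![a, b] = 0) → a = 0) : (flat ζ).IsInvertible := by
  have := finiteDimensional_alternating (E' := E) 1
  exact ⟨(LinearEquiv.ofBijective (flat ζ).toLinearMap (flat_bijective h)).toContinuousLinearEquiv,
    rfl⟩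

variable {H : Type*} [TopologicalSpace H] {I : ModelWithCorners ℝ E H}
  {M : Type*} [TopologicalSpace M] [ChartedSpace H M]

/-- A `2`-form is nondegenerate if its kernel is trivial at each point. -/
def Form.IsNondegenerate (ζ : Form I M 2) : Prop :=
  ∀ (x : M) (a : TangentSpace I x), (∀ b : TangentSpace I x, ζ x ![a, b] = 0) → a = 0

theorem Form.IsNondegenerate.eq {ζ : Form I M 2} (h : ζ.IsNondegenerate) {x : M}
    {a a' : TangentSpace I x} (haa' : ∀ b : TangentSpace I x, ζ x ![a, b] = ζ x ![a', b]) :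
    a = a' := by
  refine sub_eq_zero.mp (h x _ fun b => ?_)
  have h1 : flat (E := E) (ζ x) (a - a') ![b] = 0 := by
    refine (DFunLike.congr_fun (map_sub (flat (E := E) (ζ x)) a a') ![(b : E)]).trans ?_
    exact sub_eq_zero.mpr (haa' b)
  exact h1

variable [I.Boundaryless] [IsManifold I ∞ M] [FiniteDimensional ℝ E]

theorem Form.IsNondegenerate.exists_field {ζ : Form I M 2} (hnd : ζ.IsNondegenerate)
    (hζ : Form.IsSmooth I ζ) {h : M → ℝ} (hh : ContMDiff I 𝓘(ℝ, ℝ) ∞ h) :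
    ∃ X : ContMDiffSection I E ∞ (fun x : M => TangentSpace I x),
      ∀ (x : M) (b : TangentSpace I x), ζ x ![X x, b] = -(mfderiv I 𝓘(ℝ, ℝ) h x b) := by
  have : IsManifold I 1 M := IsManifold.of_le (n := ∞) (by simp)
  have hex : ∀ x : M, ∃ a : TangentSpace I x, ∀ b : TangentSpace I x,
      ζ x ![a, b] = -(mfderiv I 𝓘(ℝ, ℝ) h x b) := by
    intro x
    obtain ⟨a, ha⟩ := (flat_bijective (E := E) (ζ := ζ x) (hnd x)).2
      (ContinuousAlternatingMap.ofSubsingleton ℝ E ℝ (0 : Fin 1)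
        (-(mfderiv I 𝓘(ℝ, ℝ) h x : E →L[ℝ] ℝ)))
    exact ⟨a, fun b => DFunLike.congr_fun ha ![(b : E)]⟩
  choose X hX using hex
  refine ⟨⟨X, fun x => ?_⟩, hX⟩
  set χ := extChartAt I x with hχ
  -- the components of the field in the chart
  let ω' : E → E [⋀^Fin 2]→L[ℝ] ℝ := Form.inChart I ζ x
  let β : E → E [⋀^Fin 1]→L[ℝ] ℝ := fun y =>
    ContinuousAlternatingMap.ofSubsingletonLIE (𝕜 := ℝ) (E := E) (F := ℝ) (0 : Fin 1)
      (-(fderiv ℝ (h ∘ χ.symm) y))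
  let Xc : E → E := fun y => (flat (ω' y)).inverse (β y)
  have hxt : χ x ∈ χ.target := mem_extChartAt_target x
  have hsymm : ∀ y ∈ χ.target, ContMDiffAt 𝓘(ℝ, E) I ∞ χ.symm y :=
    fun y hy => Form.contMDiffAt_extChartAt_symm hy
  have hω' : ∀ y (a b : E), ω' y ![a, b] = ζ (χ.symm y)
      ![mfderiv 𝓘(ℝ, E) I χ.symm y a, mfderiv 𝓘(ℝ, E) I χ.symm y b] := by
    intro y a b
    have h1 : ω' y = Form.pullback 𝓘(ℝ, E) I χ.symm ζ y :=
      congrFun (Form.inChart_eq_pullback ζ x) y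
    exact (DFunLike.congr_fun h1 _).trans (Form.pullback_apply_two _ _ _ _ _)
  have hinv : ∀ y ∈ χ.target, (mfderiv 𝓘(ℝ, E) I χ.symm y).IsInvertible := by
    intro y hy
    have h1 := isInvertible_mfderivWithin_extChartAt_symm (I := I) hy
    rwa [I.range_eq_univ, mfderivWithin_univ] at h1
  have hnd' : ∀ y ∈ χ.target, ∀ a : E, (∀ b, ω' y ![a, b] = 0) → a = 0 := by
    intro y hy a ha
    refine (hinv y hy).injective (Eq.trans ?_ (map_zero (mfderiv 𝓘(ℝ, E) I χ.symm y)).symm)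
    refine hnd _ _ fun b => ?_
    obtain ⟨b', rfl⟩ := (hinv y hy).surjective b
    exact (hω' y a b').symm.trans (ha b')
  have hXc : ∀ y ∈ χ.target, mfderiv 𝓘(ℝ, E) I χ.symm y (Xc y) = X (χ.symm y) := by
    intro y hy
    refine hnd.eq fun b => ?_
    rw [hX]
    obtain ⟨b', rfl⟩ := (hinv y hy).surjective b
    refine (hω' y (Xc y) b').symm.trans ?_
    have h1 : flat (ω' y) (Xc y) = β y := (flat_isInvertible (hnd' y hy)).self_apply_inverse _
    refine (DFunLike.congr_fun h1 ![b']).trans ?_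
    have h2 := mfderiv_comp_apply (I := 𝓘(ℝ, E)) (I' := I) (I'' := 𝓘(ℝ, ℝ)) y
      (hh.mdifferentiable (by simp) (χ.symm y)) ((hsymm y hy).mdifferentiableAt (by simp)) b'
    rw [mfderiv_eq_fderiv] at h2
    exact congrArg Neg.neg h2
  have hω's : ContDiffAt ℝ ∞ ω' (χ x) := Form.isSmooth_iff.mp hζ x
  have hβs : ContDiffAt ℝ ∞ β (χ x) := by
    have h1 : ContDiffAt ℝ ∞ (h ∘ χ.symm) (χ x) :=
      (hh.contMDiffAt.comp (χ x) (hsymm _ hxt)).contDiffAt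
    exact (LinearIsometryEquiv.contDiff _).contDiffAt.comp (χ x)
      (h1.fderiv_right (m := ∞) (by simp)).neg
  have hXcs : ContDiffAt ℝ ∞ Xc (χ x) := by
    have h1 : ContDiffAt ℝ ∞ (fun y => flat (ω' y)) (χ x) :=
      contDiff_flat.contDiffAt.comp (χ x) hω's
    have h2 := (flat_isInvertible (hnd' _ hxt)).contDiffAt_map_inverse (n := ∞)
    exact (h2.comp (χ x) h1).clm_apply hβs
  have hus : ContMDiffAt I 𝓘(ℝ, E) ∞ (fun z => Xc (χ z)) x :=
    hXcs.contMDiffAt.comp x contMDiffAt_extChartAt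
  refine (Form.contMDiffAt_coordField hus).congr_of_eventuallyEq ?_
  filter_upwards [(isOpen_extChartAt_source (I := I) x).mem_nhds (mem_extChartAt_source x)]
    with z hz
  have hz' : z ∈ (chartAt H x).source := by simpa using hz
  have h3 := TangentBundle.symmL_trivializationAt (I := I) hz'
  rw [I.range_eq_univ, mfderivWithin_univ] at h3
  have h4 : χ.symm (χ z) = z := χ.left_inv hz
  have h5 := hXc (χ z) (χ.map_source hz)
  rw [← Bundle.Trivialization.symmL_apply (R := ℝ) _ hz' (Xc (χ z)), h3]
  have h6 : @Eq E (X (χ.symm (χ z))) (X z) := by rw [h4]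
  exact congrArg (Bundle.TotalSpace.mk z) (h6.symm.trans h5.symm)

end Musical

end GyroReduction

namespace GyroReduction

/-! ### Smoothness of fields along maps -/

section Along

variable {E : Type*} [NormedAddCommGroup E] [NormedSpace ℝ E]
  {H : Type*} [TopologicalSpace H] {I : ModelWithCorners ℝ E H}
  {M : Type*} [TopologicalSpace M] [ChartedSpace H M] [IsManifold I ∞ M]
  {E' : Type*} [NormedAddCommGroup E'] [NormedSpace ℝ E']
  {H' : Type*} [TopologicalSpace H'] {I' : ModelWithCorners ℝ E' H'}
  {M' : Type*} [TopologicalSpace M'] [ChartedSpace H' M'] [IsManifold I' ∞ M']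
  {E'' : Type*} [NormedAddCommGroup E''] [NormedSpace ℝ E'']
  {H'' : Type*} [TopologicalSpace H''] {I'' : ModelWithCorners ℝ E'' H''}
  {N : Type*} [TopologicalSpace N] [ChartedSpace H'' N] [IsManifold I'' ∞ N]

/-- A smooth family of maps carries a smooth field along a map to a smooth field along a map. -/
theorem contMDiffAt_mfderiv_apply {F : N → M → M'} {g : N → M} {n₀ : N}
    (hF : ContMDiffAt (I''.prod I) I' ∞ (fun q : N × M => F q.1 q.2) (n₀, g n₀))
    {V : (n : N) → TangentSpace I (g n)}
    (hV : ContMDiffAt I'' I.tangent ∞ (fun n => (⟨g n, V n⟩ : TangentBundle I M)) n₀) :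
    ContMDiffAt I'' I'.tangent ∞
      (fun n => (⟨F n (g n), mfderiv I I' (F n) (g n) (V n)⟩ : TangentBundle I' M')) n₀ := by
  have : IsManifold I 1 M := IsManifold.of_le (n := ∞) (by simp)
  have : IsManifold I' 1 M' := IsManifold.of_le (n := ∞) (by simp)
  have hg : ContMDiffAt I'' I ∞ g n₀ := (Bundle.contMDiffAt_totalSpace.mp hV).1
  have h1 := ContMDiffAt.mfderiv (m := ∞) F g hF hg (by simp)
  exact ContMDiffAt.clm_apply_of_inCoordinates (b₁ := g) (b₂ := fun n => F n (g n))
    (F₁ := E) (F₂ := E') (E₁ := (TangentSpace I : M → Type _))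
    (E₂ := (TangentSpace I' : M' → Type _)) (ϕ := fun n => mfderiv I I' (F n) (g n)) (v := V)
    h1 hV (hF.comp n₀ (contMDiffAt_id.prodMk hg))

theorem contMDiffAt_tangentMap {f : M → M'} {w : TangentBundle I M}
    (hf : ContMDiffAt I I' ∞ f w.proj) :
    ContMDiffAt I.tangent I'.tangent ∞ (tangentMap I I' f) w := by
  have h := contMDiffAt_mfderiv_apply (N := TangentBundle I M) (I'' := I.tangent)
    (F := fun _ => f) (g := Bundle.TotalSpace.proj) (V := fun w => w.snd) (n₀ := w)
    (hf.comp (w, w.proj) contMDiffAt_snd) contMDiffAt_id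
  exact h

theorem contMDiffAt_metric (m : Metric I M) {b : N → M} {n₀ : N}
    {V W : (n : N) → TangentSpace I (b n)}
    (hV : ContMDiffAt I'' I.tangent ∞ (fun n => (⟨b n, V n⟩ : TangentBundle I M)) n₀)
    (hW : ContMDiffAt I'' I.tangent ∞ (fun n => (⟨b n, W n⟩ : TangentBundle I M)) n₀) :
    ContMDiffAt I'' 𝓘(ℝ, ℝ) ∞ (fun n => m.inner (b n) (V n) (W n)) n₀ := by
  have hb : ContMDiffAt I'' I ∞ b n₀ := (Bundle.contMDiffAt_totalSpace.mp hV).1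
  have h : ContMDiffAt I'' (I.prod 𝓘(ℝ, ℝ)) ∞
      (fun n => Bundle.TotalSpace.mk' ℝ (E := Bundle.Trivial M ℝ) (b n)
        (m.inner (b n) (V n) (W n))) n₀ := by
    apply ContMDiffAt.clm_bundle_apply₂ (F₁ := E) (F₂ := E)
    · exact ContMDiffAt.comp n₀ m.contMDiff.contMDiffAt hb
    · exact hV
    · exact hW
  exact (Bundle.contMDiffAt_totalSpace.mp h).2

/-- Smooth fields along a map form a module over the smooth functions. -/
theorem contMDiffAt_add_smul {b : N → M} {n₀ : N} {V W : (n : N) → TangentSpace I (b n)}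
    {r : N → ℝ} (hr : ContMDiffAt I'' 𝓘(ℝ, ℝ) ∞ r n₀)
    (hV : ContMDiffAt I'' I.tangent ∞ (fun n => (⟨b n, V n⟩ : TangentBundle I M)) n₀)
    (hW : ContMDiffAt I'' I.tangent ∞ (fun n => (⟨b n, W n⟩ : TangentBundle I M)) n₀) :
    ContMDiffAt I'' I.tangent ∞
      (fun n => (⟨b n, V n + r n • W n⟩ : TangentBundle I M)) n₀ := by
  rw [Bundle.contMDiffAt_totalSpace] at hV hW ⊢
  refine ⟨hV.1, ?_⟩
  set e := trivializationAt E (TangentSpace I : M → Type _) (b n₀)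
  have h := hV.2.add (hr.smul hW.2)
  refine h.congr_of_eventuallyEq ?_
  have hb : ∀ᶠ n in 𝓝 n₀, b n ∈ e.baseSet :=
    hV.1.continuousAt.eventually (e.open_baseSet.mem_nhds (mem_baseSet_trivializationAt E _ _))
  filter_upwards [hb] with n hn
  have hlin := e.linear ℝ hn
  exact (hlin.map_add _ _).trans (congrArg _ (hlin.map_smul _ _))

end Along

/-! ### The Lagrange forms and the energy -/

section Lagrange

variable {E : Type*} [NormedAddCommGroup E] [NormedSpace ℝ E] [FiniteDimensional ℝ E]
  {H : Type*} [TopologicalSpace H] {I : ModelWithCorners ℝ E H} [I.Boundaryless]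
  {M : Type*} [TopologicalSpace M] [ChartedSpace H M] [IsManifold I ∞ M]

theorem contMDiff_tangentProj : ContMDiff I.tangent I ∞
    (Bundle.TotalSpace.proj : TangentBundle I M → M) :=
  Bundle.contMDiff_proj _

theorem lagrangeOne_apply (m : Metric I M) (w : TangentBundle I M)
    (Y : TangentSpace I.tangent w) :
    lagrangeOne m w ![Y] = m.inner w.proj w.snd
      (mfderiv I.tangent I (Bundle.TotalSpace.proj : TangentBundle I M → M) w Y) := rfl

theorem isSmooth_lagrangeOne (m : Metric I M) : Form.IsSmooth I.tangent (lagrangeOne m) := by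
  refine Form.isSmooth_iff.mpr fun w => Form.smoothAt_of_apply fun V hV => ?_
  refine contMDiffAt_metric m (b := Bundle.TotalSpace.proj) (V := fun w => w.snd)
    contMDiffAt_id ?_
  exact contMDiffAt_mfderiv_apply (F := fun _ : TangentBundle I M => Bundle.TotalSpace.proj)
    (g := id) (V := V 0) (contMDiff_tangentProj.contMDiffAt.comp _ contMDiffAt_snd) (hV 0)

theorem isSmooth_lagrangeTwo (m : Metric I M) : Form.IsSmooth I.tangent (lagrangeTwo m) :=
  (isSmooth_lagrangeOne m).d

theorem contMDiff_energy (S : NaturalSystem I M) : ContMDiff I.tangent 𝓘(ℝ, ℝ) ∞ S.energy := by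
  intro w
  have h1 := contMDiffAt_metric S.metric (b := Bundle.TotalSpace.proj) (V := fun w => w.snd)
    (W := fun w => w.snd) (n₀ := w) contMDiffAt_id contMDiffAt_id
  have h2 := S.smooth_potential.contMDiffAt.comp w contMDiff_tangentProj.contMDiffAt
  exact (contMDiffAt_const.mul h1).add h2

end Lagrange

end GyroReduction

namespace GyroReduction

/-! ### Nondegeneracy of the Lagrange `2`-form -/

section Nondegenerate

variable {E : Type*} [NormedAddCommGroup E] [NormedSpace ℝ E] [FiniteDimensional ℝ E]
  {H : Type*} [TopologicalSpace H] {I : ModelWithCorners ℝ E H} [I.Boundaryless]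
  {M : Type*} [TopologicalSpace M] [ChartedSpace H M] [IsManifold I ∞ M]

/-- The charts of the tangent bundle are the tangent maps of the charts of the base. -/
theorem extChartAt_tangent_symm (w : TangentBundle I M) {q : E × E}
    (hq : q.1 ∈ (extChartAt I w.proj).target) :
    (extChartAt I.tangent w).symm q =
      ⟨(extChartAt I w.proj).symm q.1,
        mfderiv 𝓘(ℝ, E) I (extChartAt I w.proj).symm q.1 q.2⟩ := by
  have : IsManifold I 1 M := IsManifold.of_le (n := ∞) (by simp)
  have hs : (extChartAt I w.proj).symm q.1 ∈ (chartAt H w.proj).source := by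
    simpa using (extChartAt I w.proj).map_target hq
  have h3 := TangentBundle.symmL_trivializationAt (I := I) hs
  rw [I.range_eq_univ, mfderivWithin_univ, (extChartAt I w.proj).right_inv hq] at h3
  have h4 := (trivializationAt E (TangentSpace I : M → Type _) w.proj).mk_symm hs q.2
  rw [← Bundle.Trivialization.symmL_apply (R := ℝ) _ hs, h3] at h4
  refine Eq.trans ?_ h4.symm
  rw [FiberBundle.extChartAt]
  rfl

theorem mem_extChartAt_tangent_target (w : TangentBundle I M) {q : E × E}
    (hq : q.1 ∈ (extChartAt I w.proj).target) : q ∈ (extChartAt I.tangent w).target := by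
  rw [FiberBundle.extChartAt_target]
  refine ⟨⟨hq, ?_⟩, mem_univ _⟩
  simpa using (extChartAt I w.proj).map_target hq

theorem mfderiv_extChartAt_symm_self (x : M) [IsManifold I 1 M] :
    mfderiv 𝓘(ℝ, E) I (extChartAt I x).symm (extChartAt I x x) = ContinuousLinearMap.id ℝ _ := by
  have h := mfderivWithin_range_extChartAt_symm (I := I) (x := x)
  rwa [I.range_eq_univ, mfderivWithin_univ] at h

/-- In the preferred charts of `T(M)` and `M`, the projection is the first projection of
`E × E`. -/
theorem mfderiv_proj_comp_symm (w : TangentBundle I M) {q : E × E}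
    (hq : q.1 ∈ (extChartAt I w.proj).target) (A : E × E) :
    mfderiv I.tangent I (Bundle.TotalSpace.proj : TangentBundle I M → M)
        ((extChartAt I.tangent w).symm q)
        (mfderiv 𝓘(ℝ, E × E) I.tangent (extChartAt I.tangent w).symm q A) =
      mfderiv 𝓘(ℝ, E) I (extChartAt I w.proj).symm q.1 A.1 := by
  set χ := extChartAt I w.proj
  have h1 := mfderiv_comp_apply (I := 𝓘(ℝ, E × E)) (I' := I.tangent) (I'' := I) q
    (g := (Bundle.TotalSpace.proj : TangentBundle I M → M))
    (contMDiff_tangentProj.mdifferentiable (by simp) _)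
    ((Form.contMDiffAt_extChartAt_symm (I := I.tangent)
      (mem_extChartAt_tangent_target w hq)).mdifferentiableAt (by simp)) A
  have h2 : Bundle.TotalSpace.proj ∘ (extChartAt I.tangent w).symm =ᶠ[𝓝 q]
      fun q : E × E => χ.symm q.1 := by
    filter_upwards [continuous_fst.continuousAt.eventually
      ((isOpen_extChartAt_target w.proj).mem_nhds hq)] with q' hq'
    rw [Function.comp_apply, extChartAt_tangent_symm w hq']
  refine h1.symm.trans ?_
  rw [h2.mfderiv_eq]
  exact Form.mfderiv_comp_hasFDerivAt (g := χ.symm) (c := Prod.fst)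
    ((Form.contMDiffAt_extChartAt_symm hq).mdifferentiableAt (by simp)) hasFDerivAt_fst A

theorem mfderiv_proj_apply (w : TangentBundle I M) (A : E × E) :
    @Eq E (mfderiv I.tangent I (Bundle.TotalSpace.proj : TangentBundle I M → M) w A) A.1 := by
  have : IsManifold I 1 M := IsManifold.of_le (n := ∞) (by simp)
  have : IsManifold I.tangent 1 (TangentBundle I M) := IsManifold.of_le (n := ∞) (by simp)
  have h := mfderiv_proj_comp_symm w (q := extChartAt I.tangent w w)
    (mem_extChartAt_target w.proj) A
  have h1 : mfderiv 𝓘(ℝ, E × E) I.tangent (extChartAt I.tangent w).symm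
      (extChartAt I.tangent w w) = ContinuousLinearMap.id ℝ _ := mfderiv_extChartAt_symm_self w
  have h2 : mfderiv 𝓘(ℝ, E) I (extChartAt I w.proj).symm
      (extChartAt I.tangent w w).1 = ContinuousLinearMap.id ℝ _ :=
    mfderiv_extChartAt_symm_self w.proj
  rw [h1, h2] at h
  have h3 : (extChartAt I.tangent w).symm (extChartAt I.tangent w w) = w := extChartAt_to_inv w
  rw [h3] at h
  exact h

theorem inChart_lagrangeOne (m : Metric I M) (w : TangentBundle I M) {q : E × E}
    (hq : q.1 ∈ (extChartAt I w.proj).target) (A : E × E) :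
    Form.inChart I.tangent (lagrangeOne m) w q ![A] =
      m.inner ((extChartAt I w.proj).symm q.1)
        (mfderiv 𝓘(ℝ, E) I (extChartAt I w.proj).symm q.1 q.2)
        (mfderiv 𝓘(ℝ, E) I (extChartAt I w.proj).symm q.1 A.1) := by
  have h1 : Form.inChart I.tangent (lagrangeOne m) w q = _ :=
    congrFun (Form.inChart_eq_pullback (lagrangeOne m) w) q
  refine (DFunLike.congr_fun h1 ![A]).trans ?_
  refine (Form.pullback_apply_one _ _ _ _).trans ?_
  refine (lagrangeOne_apply m _ _).trans ?_
  rw [mfderiv_proj_comp_symm w hq, extChartAt_tangent_symm w hq]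

/-- At the centre of the preferred chart, the Lagrange `2`-form pairs an arbitrary vector with
a vertical one through the metric. -/
theorem lagrangeTwo_apply_vertical (m : Metric I M) (w : TangentBundle I M) (a b b' : E) :
    lagrangeTwo m w ![((a, b) : E × E), ((0, b') : E × E)] =
      -(m.inner w.proj b' a) := by
  have : IsManifold I 1 M := IsManifold.of_le (n := ∞) (by simp)
  have : IsManifold I.tangent 1 (TangentBundle I M) := IsManifold.of_le (n := ∞) (by simp)
  set q₀ : E × E := extChartAt I.tangent w w with hq₀
  let ζ : E × E → (E × E) [⋀^Fin 1]→L[ℝ] ℝ := Form.inChart I.tangent (lagrangeOne m) w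
  have hζ : DifferentiableAt ℝ ζ q₀ :=
    ContDiffAt.differentiableAt (Form.isSmooth_iff.mp (isSmooth_lagrangeOne m) w) (by simp)
  have hd : lagrangeTwo m w = extDeriv ζ q₀ := Form.d_eq_extDeriv (lagrangeOne m) w
  refine (DFunLike.congr_fun hd _).trans ?_
  refine (extDeriv_one_apply hζ _ _).trans ?_
  have hq₀' : q₀.1 = extChartAt I w.proj w.proj := rfl
  have ht : ∀ᶠ q : E × E in 𝓝 q₀, q.1 ∈ (extChartAt I w.proj).target :=
    continuous_fst.continuousAt.eventually
      ((isOpen_extChartAt_target w.proj).mem_nhds (mem_extChartAt_target w.proj))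
  have e1 : (fun q => ζ q ![((0, b') : E × E)]) =ᶠ[𝓝 q₀] fun _ => 0 := by
    filter_upwards [ht] with q hq
    refine (inChart_lagrangeOne m w hq _).trans ?_
    exact (congrArg _ (map_zero _)).trans (map_zero _)
  have hx : (extChartAt I w.proj).symm q₀.1 = w.proj := extChartAt_to_inv w.proj
  have hid : mfderiv 𝓘(ℝ, E) I (extChartAt I w.proj).symm q₀.1 = ContinuousLinearMap.id ℝ _ :=
    mfderiv_extChartAt_symm_self w.proj
  have e2 : ∀ u : E, ζ (q₀.1, u) ![((a, b) : E × E)] = m.inner w.proj u a := by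
    intro u
    refine (inChart_lagrangeOne m w (q := (q₀.1, u)) (mem_extChartAt_target w.proj) _).trans ?_
    change m.inner ((extChartAt I w.proj).symm q₀.1)
        (mfderiv 𝓘(ℝ, E) I (extChartAt I w.proj).symm q₀.1 u)
        (mfderiv 𝓘(ℝ, E) I (extChartAt I w.proj).symm q₀.1 a) = _
    rw [hid]
    change (m.inner ((extChartAt I w.proj).symm q₀.1) : E →L[ℝ] E →L[ℝ] ℝ) u a = _
    rw [hx]
  -- the value of `ζ` on `(a, b)` is linear along the fibre
  have h2 : fderiv ℝ (fun q => ζ q ![((a, b) : E × E)]) q₀ (0, b') = m.inner w.proj b' a := by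
    have h3 : HasFDerivAt (fun u : E => ζ (q₀.1, u) ![((a, b) : E × E)]) _ q₀.2 :=
      HasFDerivAt.comp (g := fun q => ζ q ![((a, b) : E × E)]) (f := fun u => (q₀.1, u)) q₀.2
        (hζ.continuousAlternatingMap_apply_const _).hasFDerivAt (hasFDerivAt_prodMk_right q₀.1 q₀.2)
    let L : E →L[ℝ] ℝ := (ContinuousLinearMap.apply ℝ ℝ a).comp
      (m.inner w.proj : E →L[ℝ] E →L[ℝ] ℝ)
    have h4 : HasFDerivAt (fun u : E => ζ (q₀.1, u) ![((a, b) : E × E)]) L q₀.2 := by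
      have : (fun u : E => ζ (q₀.1, u) ![((a, b) : E × E)]) = L := funext e2
      rw [this]
      exact L.hasFDerivAt
    have h5 := DFunLike.congr_fun (h3.unique h4) b'
    exact h5
  rw [e1.fderiv_eq, h2]
  simp

theorem metric_eq_zero (m : Metric I M) {x : M} {a : TangentSpace I x}
    (h : m.inner x a a = 0) : a = 0 := by
  by_contra ha
  exact (m.pos x a ha).ne' h

/-- The form `σ + p_M^* β` is nondegenerate for each `2`-form `β`, since `p_M^* β` vanishes on
vertical vectors, while `σ` pairs them with the rest through the metric. -/
theorem isNondegenerate_lagrangeTwo_add (m : Metric I M) (β : Form I M 2) :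
    (lagrangeTwo m + Form.pullback I.tangent I
      (Bundle.TotalSpace.proj : TangentBundle I M → M) β).IsNondegenerate := by
  intro w A hA
  have hA' : ∀ B : E × E, lagrangeTwo m w ![A, B] + β w.proj ![A.1, B.1] = 0 := by
    intro B
    refine Eq.trans ?_ (hA B)
    refine congrArg (lagrangeTwo m w ![A, B] + ·) ?_
    refine Eq.trans ?_ (Form.pullback_apply_two _ β w A B).symm
    exact congrArg (β w.proj) (congrArg₂ (fun a b : E => ![a, b]) (mfderiv_proj_apply w A).symm
      (mfderiv_proj_apply w B).symm)
  have hz : ∀ c : E, β w.proj ![c, (0 : E)] = 0 := fun c =>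
    (β w.proj).map_coord_zero (1 : Fin 2) rfl
  have hz' : ∀ c : E, β w.proj ![(0 : E), c] = 0 := fun c =>
    (β w.proj).map_coord_zero (0 : Fin 2) rfl
  have h1 : A.1 = (0 : E) := by
    have h := hA' (0, A.1)
    rw [hz, add_zero] at h
    refine metric_eq_zero m (x := w.proj) ?_
    exact neg_eq_zero.mp ((lagrangeTwo_apply_vertical m w A.1 A.2 A.1).symm.trans h)
  have h2 : A.2 = (0 : E) := by
    have h := hA' (A.2, 0)
    rw [h1, hz', add_zero] at h
    refine metric_eq_zero m (x := w.proj) ?_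
    have hA1 : A = ((0, A.2) : E × E) := Prod.ext h1 rfl
    have h3 := lagrangeTwo_apply_vertical m w A.2 0 A.2
    have h4 : lagrangeTwo m w ![((A.2, 0) : E × E), ((0, A.2) : E × E)] =
        -lagrangeTwo m w ![((0, A.2) : E × E), ((A.2, 0) : E × E)] :=
      alternating_two_swap (lagrangeTwo m w) _ _
    rw [h4, ← hA1, h] at h3
    simpa using h3.symm
  exact Prod.ext h1 h2

/-- A mechanical system with gyroscopic forces has exactly one dynamical system. -/
theorem GyroscopicSystem.exists_dynamics (R : GyroscopicSystem I M) :
    ∃ X : FieldOnTM I M, ∀ Y, R.IsDynamics Y ↔ Y = X := by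
  have hnd := isNondegenerate_lagrangeTwo_add R.metric R.force
  obtain ⟨X, hX⟩ := hnd.exists_field (Form.isSmooth_iff.mpr fun w =>
    (Form.isSmooth_iff.mp (isSmooth_lagrangeTwo R.metric) w).add
      ((Form.isSmooth_iff.mp R.smooth_force _).pullback contMDiff_tangentProj.contMDiffAt))
    (contMDiff_energy R.toNaturalSystem)
  refine ⟨X, fun Y => ⟨fun hY => ?_, fun hY => hY ▸ hX⟩⟩
  ext w : 1
  exact hnd.eq fun b => (hY w b).trans (hX w b).symm

end Nondegenerate

end GyroReduction

namespace GyroReduction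

/-! ### The action of a one-parameter group -/

section Action

variable {E : Type*} [NormedAddCommGroup E] [NormedSpace ℝ E]
  {H : Type*} [TopologicalSpace H] {I : ModelWithCorners ℝ E H}
  {M : Type*} [TopologicalSpace M] [ChartedSpace H M] [IsManifold I ∞ M]
  {F : Type*} [NormedAddCommGroup F] [NormedSpace ℝ F]
  {G : Type*} [TopologicalSpace G] [ChartedSpace F G] [Group G]

theorem OneParameterGroup.map_zero (φ : OneParameterGroup F G) : φ.g 0 = 1 := by
  have h := φ.map_add 0 0
  rw [add_zero] at h
  exact left_eq_mul.mp h

theorem OneParameterGroup.comm (φ : OneParameterGroup F G) (g h : G) : g * h = h * g := by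
  obtain ⟨s, rfl⟩ := φ.surjective g
  obtain ⟨t, rfl⟩ := φ.surjective h
  rw [← φ.map_add, add_comm, φ.map_add]

variable [LieGroup 𝓘(ℝ, F) ∞ G] [MulAction G M] [ContMDiffSMul 𝓘(ℝ, F) I ∞ G M]
  (φ : OneParameterGroup F G)

variable (I M) in
/-- The parametrization of `G` enters only to determine the model space of `G`. -/
theorem contMDiff_smul_left (_ : OneParameterGroup F G) (g : G) :
    ContMDiff I I ∞ fun x : M => g • x :=
  (contMDiff_smul (I := 𝓘(ℝ, F)) (I' := I) (n := ∞) (G := G) (M := M)).comp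
    (contMDiff_const.prodMk contMDiff_id)

variable (I M) in
theorem contMDiff_flow : ContMDiff (𝓘(ℝ, ℝ).prod I) I ∞ fun q : ℝ × M => φ.g q.1 • q.2 :=
  (contMDiff_smul (I := 𝓘(ℝ, F)) (I' := I) (n := ∞) (G := G) (M := M)).comp
    ((φ.smooth.comp contMDiff_fst).prodMk contMDiff_snd)

variable (I) in
theorem contMDiff_orbit (x : M) : ContMDiff 𝓘(ℝ, ℝ) I ∞ fun τ : ℝ => φ.g τ • x :=
  (contMDiff_flow I M φ).comp (contMDiff_id.prodMk contMDiff_const)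

variable (I M) in
theorem contMDiff_generator :
    ContMDiff I I.tangent ∞ fun x : M => (⟨x, generator I M φ x⟩ : TangentBundle I M) := by
  intro x₀
  have h1 : ContMDiffAt I 𝓘(ℝ, ℝ).tangent ∞
      (fun _ : M => (⟨(0 : ℝ), (1 : ℝ)⟩ : TangentBundle 𝓘(ℝ, ℝ) ℝ)) x₀ := contMDiffAt_const
  have h2 := contMDiffAt_mfderiv_apply (I := 𝓘(ℝ, ℝ)) (I' := I) (I'' := I)
    (F := fun (x : M) (τ : ℝ) => φ.g τ • x) (g := fun _ => 0) (V := fun _ => (1 : ℝ)) (n₀ := x₀)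
    ((contMDiff_flow I M φ).comp (contMDiff_snd.prodMk contMDiff_fst)).contMDiffAt h1
  refine h2.congr_of_eventuallyEq (Filter.Eventually.of_forall fun x => ?_)
  have h3 : φ.g 0 • x = x := by rw [φ.map_zero, one_smul]
  exact congrArg (fun y : M => (⟨y, (generator I M φ x : E)⟩ : TangentBundle I M)) h3.symm

theorem mfderiv_smul_generator (g : G) (x : M) :
    mfderiv I I (fun y : M => g • y) x (generator I M φ x) = generator I M φ (g • x) := by
  have h0 : φ.g 0 • x = x := by rw [φ.map_zero, one_smul]
  have h := mfderiv_comp_apply_of_eq (I := 𝓘(ℝ, ℝ)) (I' := I) (I'' := I) (0 : ℝ)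
    (g := fun y : M => g • y) (f := fun τ : ℝ => φ.g τ • x)
    ((contMDiff_smul_left I M φ g).mdifferentiable (by simp) x)
    ((contMDiff_orbit I φ x).mdifferentiable (by simp) 0) h0 (1 : ℝ)
  refine h.symm.trans ?_
  have h1 : (fun y : M => g • y) ∘ (fun τ : ℝ => φ.g τ • x) = fun τ : ℝ => φ.g τ • g • x := by
    funext τ
    simp only [Function.comp_apply, smul_smul, φ.comm g]
  rw [h1]
  rfl

theorem mfderiv_orbit (τ : ℝ) (x : M) :
    @Eq E (mfderiv 𝓘(ℝ, ℝ) I (fun t => φ.g t • x) τ (1 : ℝ))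
      (generator I M φ (φ.g τ • x)) := by
  have h1 : (fun t => φ.g t • x) = fun t => (fun s => φ.g s • (φ.g τ • x)) (t - τ) := by
    funext t
    simp only [smul_smul, ← φ.map_add, sub_add_cancel]
  have h2 := Form.mfderiv_comp_hasFDerivAt (I := I) (g := fun s => φ.g s • (φ.g τ • x))
    (c := fun t => t - τ) (t := τ) ((contMDiff_orbit I φ _).mdifferentiable (by simp) _)
    (hasFDerivAt_id (𝕜 := ℝ) τ |>.sub_const τ) (1 : ℝ)
  rw [h1]
  refine h2.trans ?_
  rw [sub_self]
  rfl

theorem generator_orbit_zero {x : M} (hx : generator I M φ x = 0) (τ : ℝ) :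
    mfderiv 𝓘(ℝ, ℝ) I (fun t => φ.g t • x) τ = 0 := by
  have h : @Eq E (generator I M φ (φ.g τ • x)) 0 := by
    rw [← mfderiv_smul_generator, hx]
    exact _root_.map_zero _
  have h1 := mfderiv_orbit (E := E) (I := I) φ τ x
  refine ContinuousLinearMap.ext_ring ?_
  exact h1.trans h

theorem momentum_smul {S : NaturalSystem I M} (hS : S.IsSymmetric G) (g : G)
    (w : TangentBundle I M) :
    momentum φ S.metric (tangentMap I I (fun x : M => g • x) w) = momentum φ S.metric w := by
  have h := (hS g w.proj).2 (generator I M φ w.proj) w.snd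
  rw [mfderiv_smul_generator] at h
  exact h

theorem generatorNormSq_smul {S : NaturalSystem I M} (hS : S.IsSymmetric G) (g : G) (x : M) :
    generatorNormSq φ S.metric (g • x) = generatorNormSq φ S.metric x := by
  have h := (hS g x).2 (generator I M φ x) (generator I M φ x)
  rw [mfderiv_smul_generator] at h
  exact h

theorem energy_smul {S : NaturalSystem I M} (hS : S.IsSymmetric G) (g : G)
    (w : TangentBundle I M) :
    S.energy (tangentMap I I (fun x : M => g • x) w) = S.energy w := by
  have h1 := (hS g w.proj).2 w.snd w.snd
  have h2 := (hS g w.proj).1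
  unfold NaturalSystem.energy
  exact congrArg₂ (fun a b => 1 / 2 * a + b) h1 h2

theorem contMDiff_momentum (m : Metric I M) :
    ContMDiff I.tangent 𝓘(ℝ, ℝ) ∞ (momentum φ m : TangentBundle I M → ℝ) := by
  intro w
  exact contMDiffAt_metric m (b := Bundle.TotalSpace.proj)
    (V := fun w => generator I M φ w.proj) (W := fun w => w.snd)
    ((contMDiff_generator I M φ).contMDiffAt.comp w (Bundle.contMDiff_proj _).contMDiffAt)
    contMDiffAt_id

theorem contMDiff_generatorNormSq (m : Metric I M) :
    ContMDiff I 𝓘(ℝ, ℝ) ∞ (generatorNormSq φ m) := fun _ =>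
  contMDiffAt_metric m (b := id) (contMDiff_generator I M φ).contMDiffAt
    (contMDiff_generator I M φ).contMDiffAt

/-- The flow `Tg^τ` that the one-parameter group induces on the tangent bundle. -/
noncomputable def tangentFlow (I : ModelWithCorners ℝ E H) [IsManifold I ∞ M]
    (φ : OneParameterGroup F G) (τ : ℝ) (w : TangentBundle I M) :
    TangentBundle I M :=
  tangentMap I I (fun x : M => φ.g τ • x) w

theorem contMDiff_tangentFlow : ContMDiff (𝓘(ℝ, ℝ).prod I.tangent) I.tangent ∞
    fun q : ℝ × TangentBundle I M => tangentFlow I φ q.1 q.2 := by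
  intro q₀
  have h : ContMDiff ((𝓘(ℝ, ℝ).prod I.tangent).prod I) I ∞
      fun q : (ℝ × TangentBundle I M) × M => φ.g q.1.1 • q.2 :=
    (contMDiff_flow I M φ).comp ((contMDiff_fst.comp contMDiff_fst).prodMk contMDiff_snd)
  exact contMDiffAt_mfderiv_apply (I := I) (I' := I) (I'' := 𝓘(ℝ, ℝ).prod I.tangent)
    (F := fun (q : ℝ × TangentBundle I M) (x : M) => φ.g q.1 • x) (g := fun q => q.2.proj)
    (V := fun q => q.2.snd) (n₀ := q₀) h.contMDiffAt contMDiff_snd.contMDiffAt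

theorem tangentFlow_zero (w : TangentBundle I M) : tangentFlow I φ 0 w = w := by
  have h : (fun x : M => φ.g 0 • x) = id := by
    funext x
    rw [φ.map_zero, one_smul, id]
  unfold tangentFlow
  rw [h, tangentMap_id, id]

theorem mdifferentiable_tangentFlow (τ : ℝ) :
    MDifferentiable I.tangent I.tangent (tangentFlow (M := M) I φ τ) :=
  ((contMDiff_tangentFlow φ).comp (contMDiff_const.prodMk contMDiff_id)).mdifferentiable (by simp)

end Action

/-! ### Conservation of the momentum -/

section Noether

variable {E : Type*} [NormedAddCommGroup E] [NormedSpace ℝ E] [FiniteDimensional ℝ E]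
  {H : Type*} [TopologicalSpace H] {I : ModelWithCorners ℝ E H} [I.Boundaryless]
  {M : Type*} [TopologicalSpace M] [ChartedSpace H M] [IsManifold I ∞ M]
  {F : Type*} [NormedAddCommGroup F] [NormedSpace ℝ F]
  {G : Type*} [TopologicalSpace G] [ChartedSpace F G] [Group G]
  [LieGroup 𝓘(ℝ, F) ∞ G] [MulAction G M] [ContMDiffSMul 𝓘(ℝ, F) I ∞ G M]
  (φ : OneParameterGroup F G)

theorem pullback_tangentFlow_lagrangeOne {S : NaturalSystem I M} (hS : S.IsSymmetric G) (τ : ℝ) :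
    Form.pullback I.tangent I.tangent (tangentFlow I φ τ) (lagrangeOne S.metric) =
      lagrangeOne S.metric := by
  funext w
  ext Y
  have hY : Y = ![Y 0] := by
    ext i
    fin_cases i
    rfl
  rw [hY]
  refine (Form.pullback_apply_one _ _ _ _).trans ?_
  refine (lagrangeOne_apply _ _ _).trans (Eq.trans ?_ (lagrangeOne_apply _ _ _).symm)
  have h1 := mfderiv_comp_apply w (contMDiff_tangentProj.mdifferentiable (by simp) _)
    (mdifferentiable_tangentFlow φ τ w) (Y 0)
  have h2 := mfderiv_comp_apply w ((contMDiff_smul_left I M φ (φ.g τ)).mdifferentiable (by simp) _)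
    (contMDiff_tangentProj.mdifferentiable (by simp) w) (Y 0)
  have h3 := h1.symm.trans h2
  rw [h3]
  exact (hS (φ.g τ) w.proj).2 w.snd _

/-- Noether's theorem: the momentum is a first integral of the dynamical system. The flow `Tg^τ`
preserves `θ`, and `θ` takes the value `J` on its generating field `Z`, so `i_Z σ = -dJ`; hence
`dJ(X) = -σ(Z, X) = σ(X, Z) = -dH(Z) = 0` because `H` is invariant. -/
theorem momentum_conserved {S : NaturalSystem I M} (hS : S.IsSymmetric G) {X : FieldOnTM I M}
    (hX : S.IsDynamics X) (w : TangentBundle I M) :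
    mfderiv I.tangent 𝓘(ℝ, ℝ) (momentum φ S.metric) w (X w) = 0 := by
  let Z : TangentSpace I.tangent w :=
    (mfderiv 𝓘(ℝ, ℝ) I.tangent (fun t => tangentFlow I φ t w) 0 (1 : ℝ) : E × E)
  have hflow : ∀ w' : TangentBundle I M, MDifferentiable 𝓘(ℝ, ℝ) I.tangent
      (fun t => tangentFlow I φ t w') := fun w' =>
    ((contMDiff_tangentFlow φ).comp
      (contMDiff_id.prodMk contMDiff_const)).mdifferentiable (by simp)
  have h1 := Form.d_apply_of_invariant (contMDiff_tangentFlow φ) (tangentFlow_zero φ)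
    (isSmooth_lagrangeOne S.metric) (pullback_tangentFlow_lagrangeOne φ hS)
    (j := momentum φ S.metric) (fun τ w' => by
      refine (lagrangeOne_apply _ _ _).trans ?_
      have h2 := mfderiv_comp_apply (I := 𝓘(ℝ, ℝ)) τ
        (contMDiff_tangentProj.mdifferentiable (by simp) _) (hflow w' τ) (1 : ℝ)
      have h3 := mfderiv_orbit (E := E) (I := I) φ τ w'.proj
      rw [← h2]
      rw [← momentum_smul φ hS (φ.g τ) w', momentum, S.metric.symm]
      exact congrArg (fun a : E => (S.metric.inner (φ.g τ • w'.proj) : E →L[ℝ] E →L[ℝ] ℝ) a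
        (mfderiv I I (fun x : M => φ.g τ • x) w'.proj w'.snd)) h3)
    (x := w) ((contMDiff_momentum φ S.metric).mdifferentiable (by simp) w) (Z := Z) rfl (X w)
  have h2 : mfderiv I.tangent 𝓘(ℝ, ℝ) S.energy w Z = 0 := by
    have h3 := mfderiv_comp_apply_of_eq (I := 𝓘(ℝ, ℝ)) (0 : ℝ)
      ((contMDiff_energy S).mdifferentiable (by simp) w) (hflow w 0) (tangentFlow_zero φ w) (1 : ℝ)
    have h4 : S.energy ∘ (fun t => tangentFlow I φ t w) = fun _ => S.energy w :=
      funext fun t => energy_smul hS (φ.g t) w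
    rw [h4, mfderiv_const] at h3
    exact h3.symm
  have h3 := hX w Z
  rw [h2, alternating_two_swap (lagrangeTwo S.metric w)] at h3
  have h4 : lagrangeTwo S.metric w ![Z, X w] = 0 := neg_eq_zero.mp (h3.trans neg_zero)
  exact neg_eq_zero.mp (h1.symm.trans h4)

end Noether

end GyroReduction

namespace GyroReduction

/-! ### Smooth principal bundles of a one-parameter group -/

section Curve

variable {E : Type*} [NormedAddCommGroup E] [NormedSpace ℝ E]
  {H : Type*} [TopologicalSpace H] {I : ModelWithCorners ℝ E H}
  {M : Type*} [TopologicalSpace M] [ChartedSpace H M] [IsManifold I ∞ M]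

/-- A curve with zero velocity is constant. It is locally constant in charts, so no separation
axiom is needed. -/
theorem curve_eq_of_mfderiv_eq_zero {c : ℝ → M} (hc : MDifferentiable 𝓘(ℝ, ℝ) I c)
    (h : ∀ t, mfderiv 𝓘(ℝ, ℝ) I c t = 0) (s t : ℝ) : c s = c t := by
  have : IsManifold I 1 M := IsManifold.of_le (n := ∞) (by simp)
  have hcc : Continuous c := continuous_iff_continuousAt.mpr fun t => (hc t).continuousAt
  have hloc : IsLocallyConstant c := by
    refine (IsLocallyConstant.iff_eventually_eq c).mpr fun t => ?_
    have h1 : c ⁻¹' (extChartAt I (c t)).source ∈ 𝓝 t :=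
      hcc.continuousAt.preimage_mem_nhds
        ((isOpen_extChartAt_source (c t)).mem_nhds (mem_extChartAt_source (c t)))
    obtain ⟨ε, hε, hball⟩ := Metric.mem_nhds_iff.mp h1
    have hd : ∀ s ∈ Metric.ball t ε, HasFDerivAt (extChartAt I (c t) ∘ c) (0 : ℝ →L[ℝ] E) s := by
      intro s hs
      have hχ : MDifferentiableAt I 𝓘(ℝ, E) (extChartAt I (c t)) (c s) :=
        mdifferentiableAt_extChartAt (by simpa using hball hs)
      have h2 := (hχ.comp s (hc s)).hasMFDerivAt.hasFDerivAt
      have h3 := mfderiv_comp (I := 𝓘(ℝ, ℝ)) s hχ (hc s)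
      rw [h s] at h3
      have h4 : mfderiv 𝓘(ℝ, ℝ) 𝓘(ℝ, E) (extChartAt I (c t) ∘ c) s = (0 : ℝ →L[ℝ] E) :=
        h3.trans (ContinuousLinearMap.comp_zero _)
      exact h4 ▸ h2
    filter_upwards [Metric.ball_mem_nhds t hε] with s hs
    have h5 := Metric.isOpen_ball.is_const_of_fderiv_eq_zero (𝕜 := ℝ)
      (convex_ball t ε).isPreconnected
      (fun s hs => (hd s hs).differentiableAt.differentiableWithinAt)
      (fun s hs => (hd s hs).fderiv) hs (Metric.mem_ball_self hε)
    exact (extChartAt I (c t)).injOn (hball hs) (mem_extChartAt_source (c t)) h5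
  exact hloc.apply_eq_of_isPreconnected isPreconnected_univ (mem_univ s) (mem_univ t)

end Curve

namespace IsPrincipalBundle

variable {E : Type*} [NormedAddCommGroup E] [NormedSpace ℝ E]
  {H : Type*} [TopologicalSpace H] {I : ModelWithCorners ℝ E H}
  {M : Type*} [TopologicalSpace M] [ChartedSpace H M] [IsManifold I ∞ M]
  {E' : Type*} [NormedAddCommGroup E'] [NormedSpace ℝ E']
  {H' : Type*} [TopologicalSpace H'] {I' : ModelWithCorners ℝ E' H'}
  {M' : Type*} [TopologicalSpace M'] [ChartedSpace H' M'] [IsManifold I' ∞ M']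
  {F : Type*} [NormedAddCommGroup F] [NormedSpace ℝ F]
  {G : Type*} [TopologicalSpace G] [ChartedSpace F G] [Group G] [MulAction G M]
  {p : M → M'}

theorem contMDiff (hp : IsPrincipalBundle I I' F G p) : ContMDiff I I' ∞ p := hp.1

theorem mdifferentiable (hp : IsPrincipalBundle I I' F G p) : MDifferentiable I I' p :=
  hp.1.mdifferentiable (by simp)

theorem surjective (hp : IsPrincipalBundle I I' F G p) : Function.Surjective p := fun x' => by
  obtain ⟨e, he, -⟩ := hp.2 x'
  exact ⟨_, e.proj_symm_apply' (x := 1) he⟩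

theorem proj_smul (hp : IsPrincipalBundle I I' F G p) (g : G) (x : M) : p (g • x) = p x := by
  obtain ⟨e, he, -, -, h⟩ := hp.2 (p x)
  have hx : x ∈ e.source := e.mem_source.mpr he
  rw [← e.coe_fst (h x hx g).1, (h x hx g).2, e.coe_fst hx]

theorem exists_smul_eq (hp : IsPrincipalBundle I I' F G p) {x y : M} (hxy : p x = p y) :
    ∃ g : G, g • x = y := by
  obtain ⟨e, he, -, -, h⟩ := hp.2 (p x)
  have hx : x ∈ e.source := e.mem_source.mpr he
  have hy : y ∈ e.source := e.mem_source.mpr (hxy ▸ he)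
  refine ⟨(e y).2 * (e x).2⁻¹, e.injOn (h x hx _).1 hy ?_⟩
  refine (h x hx _).2.trans ?_
  rw [inv_mul_cancel_right, e.coe_fst hx, hxy]
  exact e.mk_proj_snd hy

theorem eq_one_of_smul_eq (hp : IsPrincipalBundle I I' F G p) {g : G} {x : M}
    (hg : g • x = x) : g = 1 := by
  obtain ⟨e, he, -, -, h⟩ := hp.2 (p x)
  have hx : x ∈ e.source := e.mem_source.mpr he
  have h1 := (h x hx g).2
  rw [hg] at h1
  exact right_eq_mul.mp (congrArg Prod.snd h1)

/-- There is a smooth local section through each point of the total space. -/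
theorem exists_section (hp : IsPrincipalBundle I I' F G p) (x : M) : ∃ s : M' → M, s (p x) = x ∧
    ∀ᶠ y in 𝓝 (p x), ContMDiffAt I' I ∞ s y ∧ p (s y) = y := by
  obtain ⟨e, he, -, h, -⟩ := hp.2 (p x)
  have hx : x ∈ e.source := e.mem_source.mpr he
  refine ⟨fun y => e.toOpenPartialHomeomorph.symm (y, (e x).2), e.symm_apply_mk_proj hx, ?_⟩
  filter_upwards [e.open_baseSet.mem_nhds he] with y hy
  refine ⟨?_, e.proj_symm_apply' hy⟩
  have h1 := h.contMDiffAt (e.open_target.mem_nhds (e.mem_target.mpr hy : (y, (e x).2) ∈ e.target))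
  exact h1.comp y (contMDiffAt_id.prodMk contMDiffAt_const)

theorem mfderiv_surjective (hp : IsPrincipalBundle I I' F G p) (x : M) :
    Function.Surjective (mfderiv I I' p x) := by
  obtain ⟨s, hs, h⟩ := hp.exists_section x
  intro a
  refine ⟨(mfderiv I' I s (p x) a : E), ?_⟩
  have h1 := mfderiv_comp_apply_of_eq (I := I') (I' := I) (I'' := I') (p x)
    (hp.mdifferentiable x) (h.self_of_nhds.1.mdifferentiableAt (by simp)) hs a
  have h2 : p ∘ s =ᶠ[𝓝 (p x)] id := h.mono fun y hy => hy.2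
  rw [h2.mfderiv_eq, mfderiv_id] at h1
  exact h1.symm

section Kernel

variable [LieGroup 𝓘(ℝ, F) ∞ G]

/-- The vertical space at a point embeds into the tangent space of the structure group, by the
derivative of the second component of a local trivialization. -/
theorem exists_injOn_ker (hp : IsPrincipalBundle I I' F G p) (x : M) :
    ∃ L : E →L[ℝ] F, ∀ w : TangentSpace I x, mfderiv I I' p x w = 0 → L w = 0 → w = 0 := by
  obtain ⟨e, he, h1, h2, -⟩ := hp.2 (p x)
  have hx : x ∈ e.source := e.mem_source.mpr he
  have he1 : MDifferentiableAt I (I'.prod 𝓘(ℝ, F)) e x :=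
    (h1.contMDiffAt (e.open_source.mem_nhds hx)).mdifferentiableAt (by simp)
  have he2 : MDifferentiableAt (I'.prod 𝓘(ℝ, F)) I e.toOpenPartialHomeomorph.symm (e x) :=
    (h2.contMDiffAt (e.open_target.mem_nhds (e.map_source hx))).mdifferentiableAt (by simp)
  have he3 : MDifferentiableAt I 𝓘(ℝ, F) (fun y => (e y).2) x :=
    (contMDiff_snd (n := 1)).mdifferentiable (by simp) _ |>.comp x he1
  refine ⟨mfderiv I 𝓘(ℝ, F) (fun y => (e y).2) x, fun w hw hL => ?_⟩
  have h3 : (e : M → M' × G) =ᶠ[𝓝 x] fun y => (p y, (e y).2) := by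
    filter_upwards [e.open_source.mem_nhds hx] with y hy
    exact (e.mk_proj_snd hy).symm
  have h4 : e.toOpenPartialHomeomorph.symm ∘ e =ᶠ[𝓝 x] id := by
    filter_upwards [e.open_source.mem_nhds hx] with y hy
    exact e.toOpenPartialHomeomorph.left_inv hy
  have h5 := mfderiv_comp_apply x he2 he1 w
  rw [h4.mfderiv_eq, mfderiv_id] at h5
  refine h5.trans ?_
  have h6 : mfderiv I (I'.prod 𝓘(ℝ, F)) e x w = (0 : E' × F) := by
    rw [h3.mfderiv_eq, mfderiv_prodMk (hp.mdifferentiable x) he3]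
    exact Prod.ext hw hL
  exact (congrArg _ h6).trans (map_zero (mfderiv (I'.prod 𝓘(ℝ, F)) I
    e.toOpenPartialHomeomorph.symm (e x)))

end Kernel

section Generator

variable [LieGroup 𝓘(ℝ, F) ∞ G] [ContMDiffSMul 𝓘(ℝ, F) I ∞ G M]

theorem mfderiv_generator (hp : IsPrincipalBundle I I' F G p) (φ : OneParameterGroup F G)
    (x : M) : mfderiv I I' p x (generator I M φ x) = 0 := by
  have h0 : φ.g 0 • x = x := by rw [φ.map_zero, one_smul]
  have h := mfderiv_comp_apply_of_eq (I := 𝓘(ℝ, ℝ)) (I' := I) (I'' := I') (0 : ℝ)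
    (hp.mdifferentiable x)
    ((contMDiff_orbit I φ x).mdifferentiable (by simp) 0) h0 (1 : ℝ)
  have h1 : p ∘ (fun τ : ℝ => φ.g τ • x) = fun _ => p x := funext fun τ => hp.proj_smul _ _
  rw [h1, mfderiv_const] at h
  exact h.symm

theorem mfderiv_smul_vec (hp : IsPrincipalBundle I I' F G p) (φ : OneParameterGroup F G)
    (g : G) (x : M) (w : TangentSpace I x) :
    mfderiv I I' p (g • x) (mfderiv I I (fun y : M => g • y) x w) = mfderiv I I' p x w := by
  have h := mfderiv_comp_apply (I := I) (I' := I) (I'' := I') x (hp.mdifferentiable (g • x))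
    ((contMDiff_smul_left I M φ g).mdifferentiable (by simp) x) w
  have h1 : p ∘ (fun y : M => g • y) = p := funext fun y => hp.proj_smul _ _
  rw [h1] at h
  exact h.symm

/-- The generating field has no zeros: an orbit through a zero would be constant, and `G`
would be trivial because its action is free. -/
theorem generator_ne_zero (hp : IsPrincipalBundle I I' F G p)
    (φ : OneParameterGroup F G) (hF : Module.finrank ℝ F = 1) (x : M) : generator I M φ x ≠ 0 := by
  intro hx
  have h1 : ∀ g : G, g = 1 := by
    intro g
    obtain ⟨τ, rfl⟩ := φ.surjective g
    refine hp.eq_one_of_smul_eq (x := x) ?_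
    have h2 := curve_eq_of_mfderiv_eq_zero ((contMDiff_orbit I φ x).mdifferentiable (by simp))
      (generator_orbit_zero φ hx) τ 0
    simpa [φ.map_zero] using h2
  -- the model space of the trivial group is a point, which contradicts `hF`
  have : Nontrivial F := Module.nontrivial_of_finrank_eq_succ hF
  have h3 : (chartAt F (1 : G)).target = {chartAt F (1 : G) 1} := by
    refine eq_singleton_iff_unique_mem.mpr ⟨mem_chart_target F 1, fun y hy => ?_⟩
    rw [← (chartAt F (1 : G)).right_inv hy, h1 ((chartAt F (1 : G)).symm y)]
  have := Module.punctured_nhds_neBot ℝ F (chartAt F (1 : G) 1)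
  exact not_isOpen_singleton _ (h3 ▸ (chartAt F (1 : G)).open_target)

theorem generatorNormSq_pos (hp : IsPrincipalBundle I I' F G p)
    (φ : OneParameterGroup F G) (hF : Module.finrank ℝ F = 1) (m : Metric I M) (x : M) :
    0 < generatorNormSq φ m x :=
  m.pos x _ (hp.generator_ne_zero φ hF x)

/-- The vertical space is spanned by the generating field: it embeds into the tangent space of `G`,
which is one-dimensional. -/
theorem exists_smul_generator (hp : IsPrincipalBundle I I' F G p)
    (φ : OneParameterGroup F G) (hF : Module.finrank ℝ F = 1) {x : M} {w : TangentSpace I x}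
    (hw : mfderiv I I' p x w = 0) :
    ∃ r : ℝ, w = r • generator I M φ x := by
  obtain ⟨L, hL⟩ := hp.exists_injOn_ker x
  have hv := hp.mfderiv_generator φ x
  have h1 : L (generator I M φ x) ≠ 0 := fun h => hp.generator_ne_zero φ hF x (hL _ hv h)
  obtain ⟨r, hr⟩ := exists_smul_eq_of_finrank_eq_one hF h1 (L w)
  refine ⟨r, sub_eq_zero.mp (hL _ ?_ ?_)⟩
  · rw [map_sub, map_smul, hw, hv, smul_zero, sub_zero]
  · refine (map_sub L (w : E) (r • (generator I M φ x : E))).trans ?_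
    exact sub_eq_zero.mpr ((L.map_smul r (generator I M φ x : E)).trans hr).symm

end Generator

end IsPrincipalBundle

end GyroReduction

namespace GyroReduction

/-! ### Smooth metrics from their values on vector fields -/

section HomBundle

open Bundle

variable {E : Type*} [NormedAddCommGroup E] [NormedSpace ℝ E]
  {H : Type*} [TopologicalSpace H] {I : ModelWithCorners ℝ E H}
  {M : Type*} [TopologicalSpace M] [ChartedSpace H M]
  {F₁ : Type*} [NormedAddCommGroup F₁] [NormedSpace ℝ F₁]
  {F₂ : Type*} [NormedAddCommGroup F₂] [NormedSpace ℝ F₂]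

theorem contMDiffAt_clm_of_apply [FiniteDimensional ℝ F₁] {f : M → F₁ →L[ℝ] F₂} {x : M}
    (h : ∀ a, ContMDiffAt I 𝓘(ℝ, F₂) ∞ (fun y => f y a) x) :
    ContMDiffAt I 𝓘(ℝ, F₁ →L[ℝ] F₂) ∞ f x := by
  let b := Module.finBasis ℝ F₁
  have h1 : f = fun y => ∑ i, ContinuousLinearMap.smulRightL ℝ F₁ F₂
      (LinearMap.toContinuousLinearMap (b.coord i)) (f y (b i)) := by
    funext y
    ext a
    conv_lhs => rw [← b.sum_repr a, map_sum]
    simp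
  rw [h1]
  refine ContMDiffAt.sum fun i _ => ?_
  exact (ContinuousLinearMap.contMDiff _).contMDiffAt.comp x (h (b i))

variable {E₁ : M → Type*} [∀ x, AddCommGroup (E₁ x)] [∀ x, Module ℝ (E₁ x)]
  [TopologicalSpace (TotalSpace F₁ E₁)] [∀ x, TopologicalSpace (E₁ x)]
  [FiberBundle F₁ E₁] [VectorBundle ℝ F₁ E₁]
  {E₂ : M → Type*} [∀ x, AddCommGroup (E₂ x)] [∀ x, Module ℝ (E₂ x)]
  [TopologicalSpace (TotalSpace F₂ E₂)] [∀ x, TopologicalSpace (E₂ x)]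
  [∀ x, IsTopologicalAddGroup (E₂ x)] [∀ x, ContinuousSMul ℝ (E₂ x)]
  [FiberBundle F₂ E₂] [VectorBundle ℝ F₂ E₂]

/-- A section of a bundle of linear maps is smooth if its values on the coordinate fields are. -/
theorem contMDiffAt_hom_of_apply [FiniteDimensional ℝ F₁] {φ : (y : M) → E₁ y →L[ℝ] E₂ y} {x : M}
    (h : ∀ a : F₁, ContMDiffAt I (I.prod 𝓘(ℝ, F₂)) ∞ (fun y => TotalSpace.mk' F₂ y
      (φ y ((trivializationAt F₁ E₁ x).symm y a))) x) :
    ContMDiffAt I (I.prod 𝓘(ℝ, F₁ →L[ℝ] F₂)) ∞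
      (fun y => TotalSpace.mk' (F₁ →L[ℝ] F₂) (E := fun y => E₁ y →L[ℝ] E₂ y) y (φ y)) x := by
  refine (contMDiffAt_hom_bundle _).mpr ⟨contMDiffAt_id, contMDiffAt_clm_of_apply fun a => ?_⟩
  refine (contMDiffAt_totalSpace.mp (h a)).2.congr_of_eventuallyEq ?_
  filter_upwards [(trivializationAt F₁ E₁ x).open_baseSet.mem_nhds
      (mem_baseSet_trivializationAt F₁ E₁ x), (trivializationAt F₂ E₂ x).open_baseSet.mem_nhds
      (mem_baseSet_trivializationAt F₂ E₂ x)] with y hy hy'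
  refine Eq.trans ?_ (congrFun (Trivialization.coe_linearMapAt_of_mem (R := ℝ) _ hy') _)
  change (trivializationAt F₂ E₂ x).continuousLinearMapAt ℝ y
    (φ y ((trivializationAt F₁ E₁ x).symmL ℝ y a)) = _
  rw [Trivialization.symmL_apply _ hy]
  rfl

end HomBundle

section

variable {E : Type*} [NormedAddCommGroup E] [NormedSpace ℝ E] [FiniteDimensional ℝ E]
  {H : Type*} [TopologicalSpace H] {I : ModelWithCorners ℝ E H} [I.Boundaryless]
  {M : Type*} [TopologicalSpace M] [ChartedSpace H M] [IsManifold I ∞ M]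

/-- A field of bilinear forms on the tangent spaces is smooth if its values on smooth vector
fields are. -/
theorem contMDiffAt_bilinear_of_apply
    {B : (x : M) → TangentSpace I x →L[ℝ] TangentSpace I x →L[ℝ] ℝ} {x : M}
    (h : ∀ V W : (y : M) → TangentSpace I y,
      ContMDiffAt I I.tangent ∞ (fun y => (⟨y, V y⟩ : TangentBundle I M)) x →
      ContMDiffAt I I.tangent ∞ (fun y => (⟨y, W y⟩ : TangentBundle I M)) x →
      ContMDiffAt I 𝓘(ℝ, ℝ) ∞ (fun y => B y (V y) (W y)) x) :
    ContMDiffAt I (I.prod 𝓘(ℝ, E →L[ℝ] E →L[ℝ] ℝ)) ∞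
      (fun y => Bundle.TotalSpace.mk' (E →L[ℝ] E →L[ℝ] ℝ)
        (E := fun y : M => TangentSpace I y →L[ℝ] TangentSpace I y →L[ℝ] ℝ) y (B y)) x := by
  refine contMDiffAt_hom_of_apply (E₂ := fun y : M => TangentSpace I y →L[ℝ] ℝ) fun a => ?_
  refine contMDiffAt_hom_of_apply (E₂ := Bundle.Trivial M ℝ) fun b => ?_
  refine Bundle.contMDiffAt_totalSpace.mpr ⟨contMDiffAt_id, ?_⟩
  exact h _ _ (Form.contMDiffAt_coordField (u := fun _ => a) contMDiffAt_const)
    (Form.contMDiffAt_coordField (u := fun _ => b) contMDiffAt_const)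

end

end GyroReduction

namespace GyroReduction

/-! ### The reduced metric -/

section Horizontal

variable {E : Type*} [NormedAddCommGroup E] [NormedSpace ℝ E]
  {H : Type*} [TopologicalSpace H] {I : ModelWithCorners ℝ E H}
  {M : Type*} [TopologicalSpace M] [ChartedSpace H M] [IsManifold I ∞ M]
  {E'' : Type*} [NormedAddCommGroup E''] [NormedSpace ℝ E'']
  {H'' : Type*} [TopologicalSpace H''] {I'' : ModelWithCorners ℝ E'' H''}
  {N : Type*} [TopologicalSpace N] [ChartedSpace H'' N] [IsManifold I'' ∞ N]
  {F : Type*} [NormedAddCommGroup F] [NormedSpace ℝ F]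
  {G : Type*} [TopologicalSpace G] [ChartedSpace F G] [Group G] [MulAction G M]
  (φ : OneParameterGroup F G) (m : Metric I M)

/-- The scalar product of the horizontal components of two vectors,
`⟨u, w⟩ - ⟨v, u⟩⟨v, w⟩ / ⟨v, v⟩`. -/
noncomputable def horizontalMetric (x : M) : TangentSpace I x →L[ℝ] TangentSpace I x →L[ℝ] ℝ :=
  m.inner x - (generatorNormSq φ m x)⁻¹ •
    (m.inner x (generator I M φ x)).smulRight (m.inner x (generator I M φ x))

theorem horizontalMetric_apply (x : M) (u w : TangentSpace I x) :
    horizontalMetric φ m x u w = m.inner x u w - (generatorNormSq φ m x)⁻¹ *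
      (m.inner x (generator I M φ x) u * m.inner x (generator I M φ x) w) := rfl

theorem horizontalMetric_symm (x : M) (u w : TangentSpace I x) :
    horizontalMetric φ m x u w = horizontalMetric φ m x w u := by
  rw [horizontalMetric_apply, horizontalMetric_apply, m.symm x u w, mul_comm (m.inner x _ u)]

theorem horizontalMetric_of_horizontal {x : M} {u : TangentSpace I x}
    (hu : m.inner x (generator I M φ x) u = 0) (w : TangentSpace I x) :
    horizontalMetric φ m x u w = m.inner x u w := by
  rw [horizontalMetric_apply, hu, zero_mul, mul_zero, sub_zero]

variable {φ m} in
theorem horizontalMetric_add_smul {x : M} (hx : generatorNormSq φ m x ≠ 0)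
    (u w : TangentSpace I x) (r : ℝ) :
    horizontalMetric φ m x (u + r • generator I M φ x) w = horizontalMetric φ m x u w := by
  have hx' : m.inner x (generator I M φ x) (generator I M φ x) ≠ 0 := hx
  rw [horizontalMetric_apply, horizontalMetric_apply, generatorNormSq]
  simp only [map_add, map_smul, add_apply, smul_apply,
    smul_eq_mul]
  field_simp
  ring

theorem contMDiffAt_horizontalMetric [LieGroup 𝓘(ℝ, F) ∞ G] [ContMDiffSMul 𝓘(ℝ, F) I ∞ G M]
    {b : N → M} {n₀ : N} {V W : (n : N) → TangentSpace I (b n)}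
    (hx : generatorNormSq φ m (b n₀) ≠ 0)
    (hV : ContMDiffAt I'' I.tangent ∞ (fun n => (⟨b n, V n⟩ : TangentBundle I M)) n₀)
    (hW : ContMDiffAt I'' I.tangent ∞ (fun n => (⟨b n, W n⟩ : TangentBundle I M)) n₀) :
    ContMDiffAt I'' 𝓘(ℝ, ℝ) ∞ (fun n => horizontalMetric φ m (b n) (V n) (W n)) n₀ := by
  have hb : ContMDiffAt I'' I ∞ b n₀ := (Bundle.contMDiffAt_totalSpace.mp hV).1
  have hv : ContMDiffAt I'' I.tangent ∞
      (fun n => (⟨b n, generator I M φ (b n)⟩ : TangentBundle I M)) n₀ :=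
    (contMDiff_generator I M φ).contMDiffAt.comp n₀ hb
  exact (contMDiffAt_metric m hV hW).sub
    ((((contMDiff_generatorNormSq φ m).contMDiffAt.comp n₀ hb).inv₀ hx).mul
      ((contMDiffAt_metric m hv hV).mul (contMDiffAt_metric m hv hW)))

theorem horizontalMetric_smul [LieGroup 𝓘(ℝ, F) ∞ G] [ContMDiffSMul 𝓘(ℝ, F) I ∞ G M]
    {S : NaturalSystem I M} (hS : S.IsSymmetric G) (g : G) (x : M) (u w : TangentSpace I x) :
    horizontalMetric φ S.metric (g • x) (mfderiv I I (fun y : M => g • y) x u)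
      (mfderiv I I (fun y : M => g • y) x w) = horizontalMetric φ S.metric x u w := by
  have h1 := (hS g x).2 (generator I M φ x) u
  have h2 := (hS g x).2 (generator I M φ x) w
  rw [mfderiv_smul_generator] at h1 h2
  rw [horizontalMetric_apply, horizontalMetric_apply, h1, h2, (hS g x).2, generatorNormSq_smul φ hS]

end Horizontal

namespace IsPrincipalBundle

section

variable {E : Type*} [NormedAddCommGroup E] [NormedSpace ℝ E]
  {H : Type*} [TopologicalSpace H] {I : ModelWithCorners ℝ E H}
  {M : Type*} [TopologicalSpace M] [ChartedSpace H M] [IsManifold I ∞ M]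
  {E' : Type*} [NormedAddCommGroup E'] [NormedSpace ℝ E']
  {H' : Type*} [TopologicalSpace H'] {I' : ModelWithCorners ℝ E' H'}
  {M' : Type*} [TopologicalSpace M'] [ChartedSpace H' M'] [IsManifold I' ∞ M']
  {F : Type*} [NormedAddCommGroup F] [NormedSpace ℝ F]
  {G : Type*} [TopologicalSpace G] [ChartedSpace F G] [Group G] [MulAction G M]
  {p : M → M'}

theorem exists_localSection (hp : IsPrincipalBundle I I' F G p) (x' : M') : ∃ s : M' → M,
    ∀ᶠ y in 𝓝 x', ContMDiffAt I' I ∞ s y ∧ p (s y) = y := by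
  obtain ⟨x, rfl⟩ := hp.surjective x'
  obtain ⟨s, -, hs⟩ := hp.exists_section x
  exact ⟨s, hs⟩

theorem mfderiv_mfderiv_section (hp : IsPrincipalBundle I I' F G p) {s : M' → M} {y : M'}
    (hs : ∀ᶠ z in 𝓝 y, ContMDiffAt I' I ∞ s z ∧ p (s z) = z) (a : TangentSpace I' y) :
    @Eq E' (mfderiv I I' p (s y) (mfderiv I' I s y a)) a := by
  have h1 := mfderiv_comp_apply (I := I') (I' := I) (I'' := I') y
    (hp.mdifferentiable (s y)) (hs.self_of_nhds.1.mdifferentiableAt (by simp)) a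
  have h2 : p ∘ s =ᶠ[𝓝 y] id := hs.mono fun y hy => hy.2
  rw [h2.mfderiv_eq, mfderiv_id] at h1
  exact h1.symm

variable [LieGroup 𝓘(ℝ, F) ∞ G] [ContMDiffSMul 𝓘(ℝ, F) I ∞ G M]

/-- Tangent vectors with the same projection to the base differ by the action and a vertical
vector. -/
theorem exists_eq_smul_add (hp : IsPrincipalBundle I I' F G p) (φ : OneParameterGroup F G)
    (hF : Module.finrank ℝ F = 1) {x y : M} (hxy : p x = p y) : ∃ g : G, g • x = y ∧
    ∀ (u : TangentSpace I x) (w : TangentSpace I y),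
      @Eq E' (mfderiv I I' p x u) (mfderiv I I' p y w) →
      ∃ r : ℝ, @Eq E w ((mfderiv I I (fun z : M => g • z) x u : E) +
        r • (generator I M φ (g • x) : E)) := by
  obtain ⟨g, rfl⟩ := hp.exists_smul_eq hxy
  refine ⟨g, rfl, fun u w huw => ?_⟩
  have h1 : mfderiv I I' p (g • x) (w - mfderiv I I (fun z : M => g • z) x u) = 0 := by
    rw [map_sub, sub_eq_zero]
    exact huw.symm.trans (hp.mfderiv_smul_vec φ g x u).symm
  obtain ⟨r, hr⟩ := hp.exists_smul_generator φ hF h1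
  exact ⟨r, eq_add_of_sub_eq' hr⟩

variable {S : NaturalSystem I M}

/-- The horizontal metric depends only on the projections of its arguments to the base. -/
theorem horizontalMetric_eq (hp : IsPrincipalBundle I I' F G p) (φ : OneParameterGroup F G)
    (hF : Module.finrank ℝ F = 1) (hS : S.IsSymmetric G) {x y : M} (hxy : p x = p y)
    {u w : TangentSpace I x} {u' w' : TangentSpace I y}
    (hu : @Eq E' (mfderiv I I' p x u) (mfderiv I I' p y u'))
    (hw : @Eq E' (mfderiv I I' p x w) (mfderiv I I' p y w')) :
    horizontalMetric φ S.metric x u w = horizontalMetric φ S.metric y u' w' := by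
  obtain ⟨g, rfl, h⟩ := hp.exists_eq_smul_add φ hF hxy
  obtain ⟨r, hr⟩ := h u u' hu
  obtain ⟨t, ht⟩ := h w w' hw
  have hN := (hp.generatorNormSq_pos φ hF S.metric (g • x)).ne'
  have hr' : u' = mfderiv I I (fun z : M => g • z) x u + r • generator I M φ (g • x) := hr
  have ht' : w' = mfderiv I I (fun z : M => g • z) x w + t • generator I M φ (g • x) := ht
  rw [hr', ht', horizontalMetric_add_smul hN, horizontalMetric_symm φ S.metric (g • x),
    horizontalMetric_add_smul hN, horizontalMetric_symm φ S.metric (g • x),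
    horizontalMetric_smul φ hS]

/-- Each tangent vector has the same projection as a horizontal one, whose square length is the
value of the horizontal metric. -/
theorem exists_horizontal (hp : IsPrincipalBundle I I' F G p) (φ : OneParameterGroup F G)
    (hF : Module.finrank ℝ F = 1) (m : Metric I M) {x : M} (u : TangentSpace I x) :
    ∃ u₀ : TangentSpace I x, m.inner x (generator I M φ x) u₀ = 0 ∧
      mfderiv I I' p x u₀ = mfderiv I I' p x u ∧
      horizontalMetric φ m x u u = m.inner x u₀ u₀ := by
  have hN := (hp.generatorNormSq_pos φ hF m x).ne'
  have h0 : m.inner x (generator I M φ x)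
      (u + (-(m.inner x (generator I M φ x) u / generatorNormSq φ m x)) • generator I M φ x) =
        0 := by
    have hN' : m.inner x (generator I M φ x) (generator I M φ x) ≠ 0 := hN
    rw [map_add, map_smul, smul_eq_mul, generatorNormSq]
    field_simp
    ring
  refine ⟨_, h0, ?_, ?_⟩
  · rw [map_add, map_smul, hp.mfderiv_generator φ, smul_zero, add_zero]
  · rw [← horizontalMetric_of_horizontal φ m h0, horizontalMetric_add_smul hN,
      horizontalMetric_symm φ m x u (u + _), horizontalMetric_add_smul hN]

end

section

variable {E : Type*} [NormedAddCommGroup E] [NormedSpace ℝ E] [FiniteDimensional ℝ E]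
  {H : Type*} [TopologicalSpace H] {I : ModelWithCorners ℝ E H} [I.Boundaryless]
  {M : Type*} [TopologicalSpace M] [ChartedSpace H M] [IsManifold I ∞ M]
  {E' : Type*} [NormedAddCommGroup E'] [NormedSpace ℝ E'] [FiniteDimensional ℝ E']
  {H' : Type*} [TopologicalSpace H'] {I' : ModelWithCorners ℝ E' H'} [I'.Boundaryless]
  {M' : Type*} [TopologicalSpace M'] [ChartedSpace H' M'] [IsManifold I' ∞ M']
  {F : Type*} [NormedAddCommGroup F] [NormedSpace ℝ F]
  {G : Type*} [TopologicalSpace G] [ChartedSpace F G] [Group G] [MulAction G M]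
  [LieGroup 𝓘(ℝ, F) ∞ G] [ContMDiffSMul 𝓘(ℝ, F) I ∞ G M]
  {p : M → M'} {S : NaturalSystem I M}

/-- The horizontal metric descends to a Riemannian metric on the base: it is pulled back by local
sections, and the result does not depend on the section. -/
theorem exists_metric (hp : IsPrincipalBundle I I' F G p) (φ : OneParameterGroup F G)
    (hF : Module.finrank ℝ F = 1) (hS : S.IsSymmetric G) : ∃ m' : Metric I' M',
    ∀ (x : M) (u w : TangentSpace I x), m'.inner (p x) (mfderiv I I' p x u)
      (mfderiv I I' p x w) = horizontalMetric φ S.metric x u w := by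
  choose s hs using hp.exists_localSection
  have hs1 : ∀ x', p (s x' x') = x' := fun x' => (hs x').self_of_nhds.2
  -- the metric in terms of the model spaces, where the normed structure is available
  let h' : M → E →L[ℝ] E →L[ℝ] ℝ := horizontalMetric φ S.metric
  let T : M' → E' →L[ℝ] E := fun x' => mfderiv I' I (s x') x'
  let B' : M' → E' →L[ℝ] E' →L[ℝ] ℝ := fun x' => (h' (s x' x')).bilinearComp (T x') (T x')
  let B : (x' : M') → TangentSpace I' x' →L[ℝ] TangentSpace I' x' →L[ℝ] ℝ := B'
  have hB : ∀ x' (a b : TangentSpace I' x'), B x' a b = horizontalMetric φ S.metric (s x' x')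
      (mfderiv I' I (s x') x' a) (mfderiv I' I (s x') x' b) := fun x' a b => rfl
  have hBp : ∀ x' (x : M) (a b : TangentSpace I' x') (u w : TangentSpace I x), p x = x' →
      @Eq E' (mfderiv I I' p x u) a → @Eq E' (mfderiv I I' p x w) b →
      B x' a b = horizontalMetric φ S.metric x u w := by
    intro x' x a b u w hx hu hw
    exact hp.horizontalMetric_eq φ hF hS ((hs1 x').trans hx.symm)
      ((hp.mfderiv_mfderiv_section (hs x') a).trans hu.symm)
      ((hp.mfderiv_mfderiv_section (hs x') b).trans hw.symm)
  have hB0 : ∀ x' (a : TangentSpace I' x'), ∃ u₀ : TangentSpace I (s x' x'),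
      @Eq E' (mfderiv I I' p (s x' x') u₀) a ∧ B x' a a = S.metric.inner (s x' x') u₀ u₀ := by
    intro x' a
    obtain ⟨u₀, -, h1, h2⟩ := hp.exists_horizontal φ hF S.metric
      (mfderiv I' I (s x') x' a : TangentSpace I (s x' x'))
    exact ⟨u₀, Eq.trans h1 (hp.mfderiv_mfderiv_section (hs x') a), h2⟩
  refine ⟨⟨B, fun x' a b => horizontalMetric_symm _ _ _ _ _, fun x' a ha => ?_, fun x' => ?_,
    fun x₀ => contMDiffAt_bilinear_of_apply fun V W hV hW => ?_⟩, fun x u w =>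
    hBp _ x _ _ _ _ rfl rfl rfl⟩
  · obtain ⟨u₀, h1, h2⟩ := hB0 x' a
    rw [h2]
    refine S.metric.pos _ _ fun hu => ha ?_
    rw [hu] at h1
    exact h1.symm.trans (map_zero (mfderiv I I' p (s x' x')))
  · -- the unit ball on the base is contained in the image of the unit ball upstairs
    refine ((S.metric.isVonNBounded (s x' x')).image (E := TangentSpace I (s x' x'))
      (mfderiv I I' p (s x' x'))).subset ?_
    intro a ha
    obtain ⟨u₀, h1, h2⟩ := hB0 x' a
    exact ⟨u₀, h2.symm.trans_lt ha, h1⟩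
  · have hd : ∀ V : (y : M') → TangentSpace I' y,
        ContMDiffAt I' I'.tangent ∞ (fun y => (⟨y, V y⟩ : TangentBundle I' M')) x₀ →
        ContMDiffAt I' I.tangent ∞ (fun y =>
          (⟨s x₀ y, mfderiv I' I (s x₀) y (V y)⟩ : TangentBundle I M)) x₀ := fun V hV =>
      contMDiffAt_mfderiv_apply (F := fun _ : M' => s x₀) (g := id) (V := V)
        ((hs x₀).self_of_nhds.1.comp (x₀, x₀) contMDiffAt_snd) hV
    refine (contMDiffAt_horizontalMetric φ S.metric
      (hp.generatorNormSq_pos φ hF S.metric _).ne' (hd V hV) (hd W hW)).congr_of_eventuallyEq ?_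
    filter_upwards [(hs x₀).eventually_nhds] with y hy
    exact hBp y (s x₀ y) _ _ _ _ hy.self_of_nhds.2 (hp.mfderiv_mfderiv_section hy _)
      (hp.mfderiv_mfderiv_section hy _)

theorem exists_reducedMetric (hp : IsPrincipalBundle I I' F G p) (φ : OneParameterGroup F G)
    (hF : Module.finrank ℝ F = 1) (hS : S.IsSymmetric G) : ∃ m' : Metric I' M',
    (∀ (x : M) (u w : TangentSpace I x), m'.inner (p x) (mfderiv I I' p x u)
      (mfderiv I I' p x w) = horizontalMetric φ S.metric x u w) ∧
    ∀ μ, IsReducedMetric φ p S.metric μ ↔ μ = m' := by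
  obtain ⟨m', hm'⟩ := hp.exists_metric φ hF hS
  have h1 : IsReducedMetric φ p S.metric m' := fun x u w hu _ =>
    (hm' x u w).trans (horizontalMetric_of_horizontal φ S.metric hu w)
  refine ⟨m', hm', fun μ => ⟨fun hμ => ?_, fun h => h ▸ h1⟩⟩
  have h2 : μ.inner = m'.inner := by
    funext x'
    obtain ⟨x, rfl⟩ := hp.surjective x'
    refine ContinuousLinearMap.ext fun a => ContinuousLinearMap.ext fun b => ?_
    obtain ⟨u, rfl⟩ := hp.mfderiv_surjective x a
    obtain ⟨w, rfl⟩ := hp.mfderiv_surjective x b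
    obtain ⟨u₀, hu, hu', -⟩ := hp.exists_horizontal φ hF S.metric u
    obtain ⟨w₀, hw, hw', -⟩ := hp.exists_horizontal φ hF S.metric w
    rw [← hu', ← hw']
    exact (hμ x u₀ w₀ hu hw).trans (h1 x u₀ w₀ hu hw).symm
  cases μ
  cases m'
  congr

end

end IsPrincipalBundle

end GyroReduction

namespace GyroReduction

/-! ### The reduced curvature form and the amended potential -/

section Connection

variable {E : Type*} [NormedAddCommGroup E] [NormedSpace ℝ E] [FiniteDimensional ℝ E]
  {H : Type*} [TopologicalSpace H] {I : ModelWithCorners ℝ E H} [I.Boundaryless]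
  {M : Type*} [TopologicalSpace M] [ChartedSpace H M] [IsManifold I ∞ M]
  {F : Type*} [NormedAddCommGroup F] [NormedSpace ℝ F]
  {G : Type*} [TopologicalSpace G] [ChartedSpace F G] [Group G] [MulAction G M]
  [LieGroup 𝓘(ℝ, F) ∞ G] [ContMDiffSMul 𝓘(ℝ, F) I ∞ G M]
  (φ : OneParameterGroup F G)

theorem connectionForm_apply (m : Metric I M) (x : M) (w : TangentSpace I x) :
    connectionForm φ m x ![w] =
      (generatorNormSq φ m x)⁻¹ * m.inner x (generator I M φ x) w := rfl

theorem isSmooth_connectionForm {m : Metric I M} (hN : ∀ x, generatorNormSq φ m x ≠ 0) :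
    Form.IsSmooth I (connectionForm φ m) := by
  refine Form.isSmooth_iff.mpr fun x => Form.smoothAt_of_apply fun V hV => ?_
  exact ((contMDiff_generatorNormSq φ m).contMDiffAt.inv₀ (hN x)).mul
    (contMDiffAt_metric m (b := id) (contMDiff_generator I M φ).contMDiffAt (hV 0))

theorem pullback_smul_connectionForm {S : NaturalSystem I M} (hS : S.IsSymmetric G) (g : G) :
    Form.pullback I I (fun y : M => g • y) (connectionForm φ S.metric) =
      connectionForm φ S.metric := by
  funext x
  ext Y
  have hY : Y = ![Y 0] := by
    ext i
    fin_cases i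
    rfl
  rw [hY]
  refine (Form.pullback_apply_one _ _ _ _).trans ?_
  refine (connectionForm_apply _ _ _ _).trans (Eq.trans ?_ (connectionForm_apply _ _ _ _).symm)
  have h := (hS g x).2 (generator I M φ x) (Y 0)
  rw [mfderiv_smul_generator] at h
  rw [generatorNormSq_smul φ hS, h]

theorem pullback_smul_curvatureForm {S : NaturalSystem I M} (hS : S.IsSymmetric G)
    (hN : ∀ x, generatorNormSq φ S.metric x ≠ 0) (g : G) :
    Form.pullback I I (fun y : M => g • y) (curvatureForm φ S.metric) =
      curvatureForm φ S.metric := by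
  funext x
  refine (Form.d_pullback (Form.isSmooth_iff.mp (isSmooth_connectionForm φ hN) _)
    (contMDiff_smul_left I M φ g).contMDiffAt).symm.trans ?_
  rw [pullback_smul_connectionForm φ hS]
  rfl

/-- The curvature form is horizontal, by Cartan's formula for `η`, which is invariant and takes the
constant value `1` on the generating field. -/
theorem curvatureForm_generator {S : NaturalSystem I M} (hS : S.IsSymmetric G)
    (hN : ∀ x, generatorNormSq φ S.metric x ≠ 0) (x : M) (w : TangentSpace I x) :
    curvatureForm φ S.metric x ![generator I M φ x, w] = 0 := by
  have h := Form.d_apply_of_invariant (contMDiff_flow I M φ)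
    (fun x => by rw [φ.map_zero, one_smul]) (isSmooth_connectionForm φ hN)
    (fun τ => pullback_smul_connectionForm φ hS (φ.g τ)) (j := fun _ => 1) (fun τ x => by
      have h1 := mfderiv_orbit (E := E) (I := I) φ τ x
      refine (connectionForm_apply _ _ _ _).trans ?_
      refine Eq.trans ?_ (inv_mul_cancel₀ (hN (φ.g τ • x)))
      exact congrArg (fun a : E => (generatorNormSq φ S.metric (φ.g τ • x))⁻¹ *
        (S.metric.inner (φ.g τ • x) : E →L[ℝ] E →L[ℝ] ℝ) (generator I M φ (φ.g τ • x)) a) h1)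
    (x := x) mdifferentiableAt_const (Z := generator I M φ x) rfl w
  rw [mfderiv_const] at h
  exact h.trans neg_zero

theorem curvatureForm_add_smul {S : NaturalSystem I M} (hS : S.IsSymmetric G)
    (hN : ∀ x, generatorNormSq φ S.metric x ≠ 0) (x : M) (u w : TangentSpace I x) (r t : ℝ) :
    curvatureForm φ S.metric x ![u + r • generator I M φ x, w + t • generator I M φ x] =
      curvatureForm φ S.metric x ![u, w] := by
  have h1 : ∀ (u w : TangentSpace I x) (r : ℝ),
      curvatureForm φ S.metric x ![u + r • generator I M φ x, w] =
        curvatureForm φ S.metric x ![u, w] := by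
    intro u w r
    let ζ : E [⋀^Fin 2]→L[ℝ] ℝ := curvatureForm φ S.metric x
    have h2 := DFunLike.congr_fun (map_add (flat ζ) (u : E) (r • (generator I M φ x : E)))
      ![(w : E)]
    have h3 := DFunLike.congr_fun (map_smul (flat ζ) r (generator I M φ x : E)) ![(w : E)]
    have h4 : flat ζ (generator I M φ x) ![(w : E)] = 0 := curvatureForm_generator φ hS hN x w
    refine h2.trans ?_
    refine (congrArg (flat ζ u ![(w : E)] + ·) (h3.trans (congrArg (r • ·) h4))).trans ?_
    simp only [smul_zero, add_zero]
    rfl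
  rw [h1, alternating_two_swap (curvatureForm φ S.metric x), h1,
    ← alternating_two_swap (curvatureForm φ S.metric x)]

end Connection

namespace IsPrincipalBundle

variable {E : Type*} [NormedAddCommGroup E] [NormedSpace ℝ E] [FiniteDimensional ℝ E]
  {H : Type*} [TopologicalSpace H] {I : ModelWithCorners ℝ E H} [I.Boundaryless]
  {M : Type*} [TopologicalSpace M] [ChartedSpace H M] [IsManifold I ∞ M]
  {E' : Type*} [NormedAddCommGroup E'] [NormedSpace ℝ E'] [FiniteDimensional ℝ E']
  {H' : Type*} [TopologicalSpace H'] {I' : ModelWithCorners ℝ E' H'} [I'.Boundaryless]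
  {M' : Type*} [TopologicalSpace M'] [ChartedSpace H' M'] [IsManifold I' ∞ M']
  {F : Type*} [NormedAddCommGroup F] [NormedSpace ℝ F]
  {G : Type*} [TopologicalSpace G] [ChartedSpace F G] [Group G] [MulAction G M]
  [LieGroup 𝓘(ℝ, F) ∞ G] [ContMDiffSMul 𝓘(ℝ, F) I ∞ G M]
  {p : M → M'} {S : NaturalSystem I M}

/-- The curvature form depends only on the projections of its arguments to the base. -/
theorem curvatureForm_eq (hp : IsPrincipalBundle I I' F G p) (φ : OneParameterGroup F G)
    (hF : Module.finrank ℝ F = 1) (hS : S.IsSymmetric G) {x y : M} (hxy : p x = p y)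
    {u w : TangentSpace I x} {u' w' : TangentSpace I y}
    (hu : @Eq E' (mfderiv I I' p x u) (mfderiv I I' p y u'))
    (hw : @Eq E' (mfderiv I I' p x w) (mfderiv I I' p y w')) :
    curvatureForm φ S.metric x ![u, w] = curvatureForm φ S.metric y ![u', w'] := by
  have hN : ∀ x, generatorNormSq φ S.metric x ≠ 0 :=
    fun x => (hp.generatorNormSq_pos φ hF S.metric x).ne'
  obtain ⟨g, rfl, h⟩ := hp.exists_eq_smul_add φ hF hxy
  obtain ⟨r, hr⟩ := h u u' hu
  obtain ⟨t, ht⟩ := h w w' hw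
  have hr' : u' = mfderiv I I (fun z : M => g • z) x u + r • generator I M φ (g • x) := hr
  have ht' : w' = mfderiv I I (fun z : M => g • z) x w + t • generator I M φ (g • x) := ht
  rw [hr', ht', curvatureForm_add_smul φ hS hN]
  refine Eq.trans ?_ (Form.pullback_apply_two _ _ _ _ _)
  rw [pullback_smul_curvatureForm φ hS hN]

/-- A form on the base is recovered from its pullback along a local section. -/
theorem eq_pullback_section (hp : IsPrincipalBundle I I' F G p) {n : ℕ} {β : Form I' M' n}
    {γ : Form I M n} (h : γ = Form.pullback I I' p β) {s : M' → M} {y : M'}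
    (hs : ∀ᶠ z in 𝓝 y, ContMDiffAt I' I ∞ s z ∧ p (s z) = z) :
    β y = Form.pullback I' I s γ y := by
  have h1 : p ∘ s =ᶠ[𝓝 y] id := hs.mono fun y hy => hy.2
  rw [h, ← Form.pullback_comp β (hp.mdifferentiable _)
    (hs.self_of_nhds.1.mdifferentiableAt (by simp)), Form.pullback_congr β h1, Form.pullback_id]

theorem exists_reducedCurvature (hp : IsPrincipalBundle I I' F G p) (φ : OneParameterGroup F G)
    (hF : Module.finrank ℝ F = 1) (hS : S.IsSymmetric G) : ∃ γ' : Form I' M' 2,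
    (∀ β, IsReducedCurvature I' φ p S.metric β ↔ β = γ') ∧
      Form.IsSmooth I' γ' ∧ Form.d I' γ' = 0 := by
  have hN : ∀ x, generatorNormSq φ S.metric x ≠ 0 :=
    fun x => (hp.generatorNormSq_pos φ hF S.metric x).ne'
  choose s hs using hp.exists_localSection
  let γ : Form I M 2 := curvatureForm φ S.metric
  have hη := isSmooth_connectionForm φ hN
  have hγ : Form.IsSmooth I γ := hη.d
  let γ' : Form I' M' 2 := fun x' => Form.pullback I' I (s x') γ x'
  have h1 : γ = Form.pullback I I' p γ' := by
    funext x
    ext Y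
    have hY : Y = ![Y 0, Y 1] := by
      ext i
      fin_cases i <;> rfl
    rw [hY]
    refine Eq.trans ?_ (Form.pullback_apply_two _ _ _ _ _).symm
    refine Eq.trans ?_ (Form.pullback_apply_two _ γ _ _ _).symm
    exact hp.curvatureForm_eq φ hF hS (hs (p x)).self_of_nhds.2.symm
      (hp.mfderiv_mfderiv_section (hs (p x)) _).symm (hp.mfderiv_mfderiv_section (hs (p x)) _).symm
  -- near each point, `γ'` is the pullback of `γ` by a single local section
  have h2 : ∀ x', ∀ᶠ y in 𝓝 x', Form.pullback I' I (s x') γ y = γ' y := fun x' =>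
    (hs x').eventually_nhds.mono fun y hy => (hp.eq_pullback_section h1 hy).symm
  refine ⟨γ', fun β => ⟨fun hβ => funext fun x' => hp.eq_pullback_section hβ (hs x'),
    fun h => h ▸ h1⟩, Form.isSmooth_iff.mpr fun x' => ?_, funext fun x' => ?_⟩
  · exact ((Form.isSmooth_iff.mp hγ _).pullback (hs x').self_of_nhds.1).congr (h2 x')
  · rw [← Form.d_congr (h2 x'), Form.d_pullback (Form.isSmooth_iff.mp hγ _) (hs x').self_of_nhds.1]
    have h3 : Form.d I γ = 0 := Form.d_d hη
    rw [h3]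
    ext Y
    rfl

theorem exists_amendedPotential (hp : IsPrincipalBundle I I' F G p) (φ : OneParameterGroup F G)
    (hF : Module.finrank ℝ F = 1) (hS : S.IsSymmetric G) (k : ℝ) : ∃ U : M' → ℝ,
    (∀ U', IsAmendedPotential φ p S k U' ↔ U' = U) ∧ ContMDiff I' 𝓘(ℝ, ℝ) ∞ U := by
  have hN : ∀ x, generatorNormSq φ S.metric x ≠ 0 :=
    fun x => (hp.generatorNormSq_pos φ hF S.metric x).ne'
  choose s hs using hp.exists_localSection
  let f : M → ℝ := fun x => S.potential x + k ^ 2 / (2 * generatorNormSq φ S.metric x)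
  have hf : ContMDiff I 𝓘(ℝ, ℝ) ∞ f := S.smooth_potential.add
    (contMDiff_const.div₀ (contMDiff_const.mul (contMDiff_generatorNormSq φ S.metric))
      fun x => mul_ne_zero two_ne_zero (hN x))
  have hfp : ∀ x y, p x = p y → f x = f y := by
    intro x y hxy
    obtain ⟨g, rfl⟩ := hp.exists_smul_eq hxy
    simp only [f, generatorNormSq_smul φ hS, (hS g x).1]
  refine ⟨fun x' => f (s x' x'), fun U' => ⟨fun hU => funext fun x' => ?_, fun hU x => ?_⟩,
    fun x' => ?_⟩
  · refine Eq.trans ?_ (hU (s x' x'))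
    rw [(hs x').self_of_nhds.2]
  · rw [hU]
    exact hfp _ _ (hs (p x)).self_of_nhds.2
  · refine (hf.contMDiffAt.comp x' (hs x').self_of_nhds.1).congr_of_eventuallyEq ?_
    filter_upwards [hs x'] with y hy
    exact hfp _ _ ((hs y).self_of_nhds.2.trans hy.2.symm)

end IsPrincipalBundle

end GyroReduction

namespace GyroReduction

/-! ### The fibrewise projection onto a momentum level -/

section Shift

variable {E : Type*} [NormedAddCommGroup E] [NormedSpace ℝ E]
  {H : Type*} [TopologicalSpace H] {I : ModelWithCorners ℝ E H}
  {M : Type*} [TopologicalSpace M] [ChartedSpace H M] [IsManifold I ∞ M]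
  {F : Type*} [NormedAddCommGroup F] [NormedSpace ℝ F]
  {G : Type*} [TopologicalSpace G] [ChartedSpace F G] [Group G] [MulAction G M]
  (φ : OneParameterGroup F G) (m : Metric I M) (k : ℝ)

/-- The translation of a tangent vector by a multiple of the generating field. -/
noncomputable def generatorShift (I : ModelWithCorners ℝ E H) [IsManifold I ∞ M]
    (φ : OneParameterGroup F G) (q : ℝ × TangentBundle I M) : TangentBundle I M :=
  ⟨q.2.proj, q.2.snd + q.1 • generator I M φ q.2.proj⟩

/-- The multiple of the generating field that carries a vector to the momentum level `k`. -/
noncomputable def levelCoefficient (w : TangentBundle I M) : ℝ :=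
  (k - momentum φ m w) * (generatorNormSq φ m w.proj)⁻¹

/-- The projection of `T(M)` onto the momentum level `k` along the generating field. -/
noncomputable def levelProjection (w : TangentBundle I M) : TangentBundle I M :=
  generatorShift I φ (levelCoefficient φ m k w, w)

theorem generatorShift_zero (w : TangentBundle I M) : generatorShift I φ (0, w) = w := by
  unfold generatorShift
  rw [zero_smul, add_zero]

variable {φ m k} in
theorem momentum_levelProjection {w : TangentBundle I M} (hN : generatorNormSq φ m w.proj ≠ 0) :
    momentum φ m (levelProjection φ m k w) = k := by
  have h : momentum φ m (levelProjection φ m k w) =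
      momentum φ m w + levelCoefficient φ m k w * generatorNormSq φ m w.proj := by
    refine (map_add (m.inner w.proj (generator I M φ w.proj)) _ _).trans ?_
    rw [map_smul]
    rfl
  rw [h, levelCoefficient, mul_assoc, inv_mul_cancel₀ hN, mul_one, add_sub_cancel]

variable {φ m k} in
theorem levelProjection_of_mem {w : TangentBundle I M} (hw : w ∈ momentumLevel φ m k) :
    levelProjection φ m k w = w := by
  have hw' : momentum φ m w = k := hw
  rw [levelProjection, levelCoefficient, hw', sub_self, zero_mul, generatorShift_zero]

variable [LieGroup 𝓘(ℝ, F) ∞ G] [ContMDiffSMul 𝓘(ℝ, F) I ∞ G M]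

theorem contMDiff_generatorShift : ContMDiff (𝓘(ℝ, ℝ).prod I.tangent) I.tangent ∞
    (generatorShift (M := M) I φ) := fun q =>
  contMDiffAt_add_smul (b := fun q : ℝ × TangentBundle I M => q.2.proj) (r := Prod.fst)
    (V := fun q => q.2.snd) (W := fun q => generator I M φ q.2.proj)
    contMDiffAt_fst contMDiffAt_snd
    ((contMDiff_generator I M φ).contMDiffAt.comp q
      ((Bundle.contMDiff_proj _).contMDiffAt.comp q contMDiffAt_snd))

variable {φ m} in
theorem contMDiff_levelCoefficient (hN : ∀ x, generatorNormSq φ m x ≠ 0) :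
    ContMDiff I.tangent 𝓘(ℝ, ℝ) ∞ (levelCoefficient φ m k) :=
  (contMDiff_const.sub (contMDiff_momentum φ m)).mul
    (((contMDiff_generatorNormSq φ m).comp (Bundle.contMDiff_proj _)).inv₀ fun w => hN w.proj)

variable {φ m} in
theorem contMDiff_levelProjection (hN : ∀ x, generatorNormSq φ m x ≠ 0) :
    ContMDiff I.tangent I.tangent ∞ (levelProjection φ m k) :=
  (contMDiff_generatorShift φ).comp ((contMDiff_levelCoefficient k hN).prodMk contMDiff_id)

variable {φ m k} in
/-- Vectors tangent to a momentum level are fixed by the derivative of the projection onto it. -/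
theorem mfderiv_levelProjection (hN : ∀ x, generatorNormSq φ m x ≠ 0) {w : TangentBundle I M}
    (hw : w ∈ momentumLevel φ m k) {Y : TangentSpace I.tangent w}
    (hY : mfderiv I.tangent 𝓘(ℝ, ℝ) (momentum φ m) w Y = 0) :
    @Eq (E × E) (mfderiv I.tangent I.tangent (levelProjection φ m k) w Y) Y := by
  have hw' : momentum φ m w = k := hw
  have hc0 : levelCoefficient φ m k w = 0 := by
    rw [levelCoefficient, hw', sub_self, zero_mul]
  have hc : mfderiv I.tangent 𝓘(ℝ, ℝ) (levelCoefficient φ m k) w Y = 0 := by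
    have h1 : MDifferentiableAt I.tangent 𝓘(ℝ, ℝ) (momentum φ m) w :=
      (contMDiff_momentum φ m).mdifferentiable (by simp) w
    have h2 : MDifferentiableAt I.tangent 𝓘(ℝ, ℝ)
        (fun w : TangentBundle I M => (generatorNormSq φ m w.proj)⁻¹) w :=
      (((contMDiff_generatorNormSq φ m).comp (Bundle.contMDiff_proj _)).inv₀
        fun w => hN w.proj).mdifferentiable (by simp) w
    have h3 : HasMFDerivAt I.tangent 𝓘(ℝ, ℝ) (fun w => k - momentum φ m w) w _ :=
      (hasMFDerivAt_const k w).sub h1.hasMFDerivAt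
    have h4 := (h3.mul h2.hasMFDerivAt).mfderiv
    refine (DFunLike.congr_fun h4 Y).trans ?_
    let dJ : E × E →L[ℝ] ℝ := mfderiv I.tangent 𝓘(ℝ, ℝ) (momentum φ m) w
    have hdJ : dJ Y = 0 := hY
    change (k - momentum φ m w) * _ + (generatorNormSq φ m w.proj)⁻¹ * (0 - dJ Y) = 0
    rw [hw', hdJ, sub_self, zero_mul, sub_zero, mul_zero, add_zero]
  have hs : ∀ c : TangentBundle I M → ℝ, MDifferentiableAt I.tangent 𝓘(ℝ, ℝ) c w → c w = 0 →
      mfderiv I.tangent 𝓘(ℝ, ℝ) c w Y = 0 →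
      @Eq (E × E) (mfderiv I.tangent I.tangent (fun w => generatorShift I φ (c w, w)) w Y)
        (mfderiv (𝓘(ℝ, ℝ).prod I.tangent) I.tangent (generatorShift I φ) (0, w)
          ((0, Y) : ℝ × (E × E))) := by
    intro c hcd hcw hcY
    have h1 := mfderiv_comp_apply_of_eq (I := I.tangent) (I' := 𝓘(ℝ, ℝ).prod I.tangent)
      (I'' := I.tangent) w (g := generatorShift I φ) (f := fun w => (c w, w)) (y := (0, w))
      ((contMDiff_generatorShift φ).mdifferentiable (by simp) _)
      (hcd.prodMk mdifferentiableAt_id) (by rw [hcw]) Y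
    refine h1.trans ?_
    have h2 := mfderiv_prodMk hcd (mdifferentiableAt_id (I := I.tangent) (x := w))
    refine congrArg (mfderiv (𝓘(ℝ, ℝ).prod I.tangent) I.tangent (generatorShift I φ) (0, w)) ?_
    refine (DFunLike.congr_fun h2 Y).trans ?_
    refine Prod.ext hcY ?_
    exact DFunLike.congr_fun (mfderiv_id (I := I.tangent) (x := w)) Y
  -- to first order at `w`, the projection agrees with the shift by the zero function, the identity
  have h5 := hs _ ((contMDiff_levelCoefficient k hN).mdifferentiable (by simp) w) hc0 hc
  have h6 := hs (fun _ => 0) mdifferentiableAt_const rfl (by rw [mfderiv_const]; rfl)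
  refine h5.trans (h6.symm.trans ?_)
  have h7 : (fun w : TangentBundle I M => generatorShift I φ (0, w)) = id :=
    funext (generatorShift_zero φ)
  rw [h7, mfderiv_id]
  rfl

end Shift

end GyroReduction

namespace GyroReduction

/-! ### The reduced dynamics -/

namespace IsPrincipalBundle

section

variable {E : Type*} [NormedAddCommGroup E] [NormedSpace ℝ E]
  {H : Type*} [TopologicalSpace H] {I : ModelWithCorners ℝ E H}
  {M : Type*} [TopologicalSpace M] [ChartedSpace H M] [IsManifold I ∞ M]
  {E' : Type*} [NormedAddCommGroup E'] [NormedSpace ℝ E']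
  {H' : Type*} [TopologicalSpace H'] {I' : ModelWithCorners ℝ E' H'}
  {M' : Type*} [TopologicalSpace M'] [ChartedSpace H' M'] [IsManifold I' ∞ M']
  {F : Type*} [NormedAddCommGroup F] [NormedSpace ℝ F]
  {G : Type*} [TopologicalSpace G] [ChartedSpace F G] [Group G] [MulAction G M]
  [LieGroup 𝓘(ℝ, F) ∞ G] [ContMDiffSMul 𝓘(ℝ, F) I ∞ G M]
  {p : M → M'} {m : Metric I M} {k : ℝ}

theorem contMDiff_tangentMap (hp : IsPrincipalBundle I I' F G p) :
    ContMDiff I.tangent I'.tangent ∞ (tangentMap I I' p) :=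
  fun _ => contMDiffAt_tangentMap hp.contMDiff.contMDiffAt

theorem tangentMap_levelProjection (hp : IsPrincipalBundle I I' F G p) (φ : OneParameterGroup F G)
    (w : TangentBundle I M) :
    tangentMap I I' p (levelProjection φ m k w) = tangentMap I I' p w := by
  refine congrArg (Bundle.TotalSpace.mk (p w.proj)) ?_
  refine (map_add (mfderiv I I' p w.proj) _ _).trans ?_
  rw [map_smul, hp.mfderiv_generator φ, smul_zero, add_zero]

/-- A vector is determined by its base point, its projection to the base, and its momentum. -/
theorem eq_of_momentum_eq (hp : IsPrincipalBundle I I' F G p) (φ : OneParameterGroup F G)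
    (hF : Module.finrank ℝ F = 1) {w₁ w₂ : TangentBundle I M} (hproj : w₁.proj = w₂.proj)
    (hmom : momentum φ m w₁ = momentum φ m w₂)
    (hT : tangentMap I I' p w₁ = tangentMap I I' p w₂) : w₁ = w₂ := by
  obtain ⟨x, u⟩ := w₁
  obtain ⟨y, w⟩ := w₂
  obtain rfl : x = y := hproj
  have h1 : mfderiv I I' p x u = mfderiv I I' p x w :=
    eq_of_heq (Bundle.TotalSpace.mk.inj hT).2
  obtain ⟨r, hr⟩ := hp.exists_smul_generator φ hF (x := x) (w := u - w)
    (by rw [map_sub, h1, sub_self])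
  have h2 : m.inner x (generator I M φ x) (u - w) = 0 := by
    rw [map_sub, sub_eq_zero]
    exact hmom
  rw [hr, map_smul] at h2
  have h3 : r = 0 := (mul_eq_zero.mp h2).resolve_right (hp.generatorNormSq_pos φ hF m x).ne'
  rw [h3, zero_smul, sub_eq_zero] at hr
  rw [hr]

/-- The momentum levels project onto the tangent bundle of the base. -/
theorem exists_mem_momentumLevel (hp : IsPrincipalBundle I I' F G p) (φ : OneParameterGroup F G)
    (hF : Module.finrank ℝ F = 1) (m : Metric I M) (k : ℝ) (a : TangentBundle I' M') :
    ∃ w ∈ momentumLevel φ m k, tangentMap I I' p w = a := by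
  obtain ⟨x', a⟩ := a
  obtain ⟨x, rfl⟩ := hp.surjective x'
  obtain ⟨u, rfl⟩ := hp.mfderiv_surjective x a
  exact ⟨levelProjection φ m k ⟨x, u⟩,
    momentum_levelProjection (hp.generatorNormSq_pos φ hF m x).ne',
    hp.tangentMap_levelProjection φ ⟨x, u⟩⟩

/-- At a point of a momentum level, each vector tangent to `T(M')` lifts to `T(M)`: the
composition of the tangent map of a local section with the projection onto the level is a local
section of `Tp`. -/
theorem mfderiv_tangentMap_surjective (hp : IsPrincipalBundle I I' F G p)
    (φ : OneParameterGroup F G) (hF : Module.finrank ℝ F = 1) {w : TangentBundle I M}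
    (hw : w ∈ momentumLevel φ m k) :
    Function.Surjective (mfderiv I.tangent I'.tangent (tangentMap I I' p) w) := by
  have hN : ∀ x, generatorNormSq φ m x ≠ 0 := fun x => (hp.generatorNormSq_pos φ hF m x).ne'
  obtain ⟨s, hsx, hs⟩ := hp.exists_section w.proj
  let Q : TangentBundle I' M' → TangentBundle I M := levelProjection φ m k ∘ tangentMap I' I s
  have hQd : ContMDiffAt I'.tangent I.tangent ∞ Q (tangentMap I I' p w) :=
    (contMDiff_levelProjection k hN).contMDiffAt.comp _
      (contMDiffAt_tangentMap hs.self_of_nhds.1)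
  have hQ : ∀ᶠ a : TangentBundle I' M' in 𝓝 (tangentMap I I' p w), tangentMap I I' p (Q a) = a := by
    have h1 : ContinuousAt (Bundle.TotalSpace.proj : TangentBundle I' M' → M')
        (tangentMap I I' p w) :=
      (Bundle.contMDiff_proj (n := ∞) (IB := I') _).continuous.continuousAt
    filter_upwards [h1.eventually hs.eventually_nhds] with a ha
    refine (hp.tangentMap_levelProjection φ _).trans ?_
    obtain ⟨y, b⟩ := a
    have h2 := tangentMap_comp_at (I := I') (I' := I) (I'' := I') (⟨y, b⟩ : TangentBundle I' M')
      (hp.mdifferentiable (s y)) (ha.self_of_nhds.1.mdifferentiableAt (by simp))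
    have h3 : p ∘ s =ᶠ[𝓝 y] id := ha.mono fun z hz => hz.2
    refine h2.symm.trans ?_
    have h4 : tangentMap I' I' (p ∘ s) ⟨y, b⟩ = tangentMap I' I' id ⟨y, b⟩ := by
      have h5 : (p ∘ s) y = y := h3.self_of_nhds
      have h6 : (mfderiv I' I' (p ∘ s) y : E' →L[ℝ] E') = mfderiv I' I' id y := h3.mfderiv_eq
      exact congrArg₂ (fun (z : M') (c : E') => (⟨z, c⟩ : TangentBundle I' M')) h5
        (DFunLike.congr_fun h6 b)
    rw [h4, tangentMap_id, id]
  have hQw : Q (tangentMap I I' p w) = w := by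
    refine hp.eq_of_momentum_eq φ hF (m := m) hsx ?_ hQ.self_of_nhds
    exact (momentum_levelProjection (hN _)).trans (Eq.symm hw)
  intro b
  refine ⟨(mfderiv I'.tangent I.tangent Q (tangentMap I I' p w) b : E × E), ?_⟩
  have h1 := mfderiv_comp_apply_of_eq (I := I'.tangent) (I' := I.tangent) (I'' := I'.tangent)
    (tangentMap I I' p w) (hp.contMDiff_tangentMap.mdifferentiable (by simp) w)
    (hQd.mdifferentiableAt (by simp)) hQw b
  have h2 : tangentMap I I' p ∘ Q =ᶠ[𝓝 (tangentMap I I' p w)] id := hQ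
  rw [h2.mfderiv_eq, mfderiv_id] at h1
  exact h1.symm

end

section

variable {E : Type*} [NormedAddCommGroup E] [NormedSpace ℝ E] [FiniteDimensional ℝ E]
  {H : Type*} [TopologicalSpace H] {I : ModelWithCorners ℝ E H} [I.Boundaryless]
  {M : Type*} [TopologicalSpace M] [ChartedSpace H M] [IsManifold I ∞ M]
  {E' : Type*} [NormedAddCommGroup E'] [NormedSpace ℝ E'] [FiniteDimensional ℝ E']
  {H' : Type*} [TopologicalSpace H'] {I' : ModelWithCorners ℝ E' H'} [I'.Boundaryless]
  {M' : Type*} [TopologicalSpace M'] [ChartedSpace H' M'] [IsManifold I' ∞ M']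
  {F : Type*} [NormedAddCommGroup F] [NormedSpace ℝ F]
  {G : Type*} [TopologicalSpace G] [ChartedSpace F G] [Group G] [MulAction G M]
  [LieGroup 𝓘(ℝ, F) ∞ G] [ContMDiffSMul 𝓘(ℝ, F) I ∞ G M]
  {p : M → M'} {m : Metric I M} {m' : Metric I' M'} {k : ℝ}

/-- On the momentum level `k`, the Lagrange `1`-forms of `M` and of the base differ by `k` times
the connection form. -/
theorem pullback_levelProjection_lagrangeOne (hp : IsPrincipalBundle I I' F G p)
    (φ : OneParameterGroup F G) (hF : Module.finrank ℝ F = 1)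
    (hm' : ∀ (x : M) (u w : TangentSpace I x), m'.inner (p x) (mfderiv I I' p x u)
      (mfderiv I I' p x w) = horizontalMetric φ m x u w) :
    Form.pullback I.tangent I.tangent (levelProjection φ m k) (lagrangeOne m) =
      Form.pullback I.tangent I'.tangent (tangentMap I I' p) (lagrangeOne m') +
        k • Form.pullback I.tangent I Bundle.TotalSpace.proj (connectionForm φ m) := by
  have hN : ∀ x, generatorNormSq φ m x ≠ 0 := fun x => (hp.generatorNormSq_pos φ hF m x).ne'
  funext w
  ext Y
  have hY : Y = ![Y 0] := by
    ext i
    fin_cases i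
    rfl
  rw [hY]
  generalize Y 0 = y
  set b : TangentSpace I w.proj :=
    mfderiv I.tangent I (Bundle.TotalSpace.proj : TangentBundle I M → M) w y with hb
  have h1 : Form.pullback I.tangent I.tangent (levelProjection φ m k) (lagrangeOne m) w ![y] =
      m.inner w.proj (w.snd + levelCoefficient φ m k w • generator I M φ w.proj) b := by
    refine (Form.pullback_apply_one _ _ _ _).trans ?_
    refine (lagrangeOne_apply _ _ _).trans ?_
    have h := mfderiv_comp_apply w (contMDiff_tangentProj.mdifferentiable (by simp) _)
      ((contMDiff_levelProjection k hN).mdifferentiable (by simp) w) y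
    exact congrArg (m.inner w.proj
      (w.snd + levelCoefficient φ m k w • generator I M φ w.proj)) h.symm
  have h2 : Form.pullback I.tangent I'.tangent (tangentMap I I' p) (lagrangeOne m') w ![y] =
      horizontalMetric φ m w.proj w.snd b := by
    refine (Form.pullback_apply_one _ _ _ _).trans ?_
    refine (lagrangeOne_apply _ _ _).trans ?_
    have h := mfderiv_comp_apply w
      (contMDiff_tangentProj.mdifferentiable (by simp) (tangentMap I I' p w))
      (hp.contMDiff_tangentMap.mdifferentiable (by simp) w) y
    have h' := mfderiv_comp_apply w (hp.mdifferentiable w.proj)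
      (contMDiff_tangentProj.mdifferentiable (by simp) w) y
    rw [← hm']
    exact congrArg (m'.inner (p w.proj) (mfderiv I I' p w.proj w.snd)) (h.symm.trans h')
  have h3 : Form.pullback I.tangent I Bundle.TotalSpace.proj (connectionForm φ m) w ![y] =
      (generatorNormSq φ m w.proj)⁻¹ * m.inner w.proj (generator I M φ w.proj) b :=
    (Form.pullback_apply_one _ _ _ _).trans (connectionForm_apply _ _ _ _)
  refine h1.trans (Eq.trans ?_ (congrArg₂ (fun r t : ℝ => r + k * t) h2 h3).symm)
  rw [horizontalMetric_apply, map_add, map_smul, levelCoefficient, momentum]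
  simp only [add_apply, smul_apply, smul_eq_mul]
  ring

theorem pullback_levelProjection_lagrangeTwo (hp : IsPrincipalBundle I I' F G p)
    (φ : OneParameterGroup F G) (hF : Module.finrank ℝ F = 1)
    (hm' : ∀ (x : M) (u w : TangentSpace I x), m'.inner (p x) (mfderiv I I' p x u)
      (mfderiv I I' p x w) = horizontalMetric φ m x u w)
    {γ' : Form I' M' 2} (hγ' : IsReducedCurvature I' φ p m γ') :
    Form.pullback I.tangent I.tangent (levelProjection φ m k) (lagrangeTwo m) =
      Form.pullback I.tangent I'.tangent (tangentMap I I' p)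
        (lagrangeTwo m' + Form.pullback I'.tangent I' Bundle.TotalSpace.proj (k • γ')) := by
  have hN : ∀ x, generatorNormSq φ m x ≠ 0 := fun x => (hp.generatorNormSq_pos φ hF m x).ne'
  have hπ := contMDiff_levelProjection (φ := φ) (m := m) k hN
  have hη := isSmooth_connectionForm φ hN
  funext w
  have h1 : Form.pullback I.tangent I.tangent (levelProjection φ m k) (lagrangeTwo m) w = _ :=
    (Form.d_pullback (Form.isSmooth_iff.mp (isSmooth_lagrangeOne m) _) hπ.contMDiffAt).symm
  have h2 := (Form.isSmooth_iff.mp (isSmooth_lagrangeOne m') (tangentMap I I' p w)).pullback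
    hp.contMDiff_tangentMap.contMDiffAt
  have h3 := (Form.isSmooth_iff.mp hη w.proj).pullback (contMDiff_tangentProj (I := I)).contMDiffAt
  rw [h1, hp.pullback_levelProjection_lagrangeOne φ hF hm', Form.d_add h2 (h3.smul k),
    Form.d_smul, Form.d_pullback (Form.isSmooth_iff.mp hη w.proj)
      (contMDiff_tangentProj (I := I)).contMDiffAt,
    Form.d_pullback (Form.isSmooth_iff.mp (isSmooth_lagrangeOne m') (tangentMap I I' p w))
      hp.contMDiff_tangentMap.contMDiffAt]
  have h4 : Form.d I (connectionForm φ m) = Form.pullback I I' p γ' := hγ'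
  have h5 := Form.pullback_comp γ' (hp.mdifferentiable w.proj)
    (contMDiff_tangentProj.mdifferentiable (by simp) w)
  have h6 := Form.pullback_comp γ'
    (contMDiff_tangentProj.mdifferentiable (by simp) (tangentMap I I' p w))
    (hp.contMDiff_tangentMap.mdifferentiable (by simp) w)
  rw [h4, ← h5]
  have h7 : Form.pullback I.tangent I' (p ∘ Bundle.TotalSpace.proj) γ' w =
    Form.pullback I.tangent I'.tangent (tangentMap I I' p)
      (Form.pullback I'.tangent I' Bundle.TotalSpace.proj γ') w := h6
  rw [h7]
  rfl

/-- The energy of the reduced system is the energy on the momentum level. -/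
theorem energy_levelProjection (hp : IsPrincipalBundle I I' F G p)
    (φ : OneParameterGroup F G) (hF : Module.finrank ℝ F = 1) {S : NaturalSystem I M}
    {R : NaturalSystem I' M'}
    (hm' : ∀ (x : M) (u w : TangentSpace I x), R.metric.inner (p x) (mfderiv I I' p x u)
      (mfderiv I I' p x w) = horizontalMetric φ S.metric x u w)
    (hU : IsAmendedPotential φ p S k R.potential) (w : TangentBundle I M) :
    S.energy (levelProjection φ S.metric k w) = R.energy (tangentMap I I' p w) := by
  have hN : S.metric.inner w.proj (generator I M φ w.proj) (generator I M φ w.proj) ≠ 0 :=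
    (hp.generatorNormSq_pos φ hF S.metric w.proj).ne'
  have h1 : S.energy (levelProjection φ S.metric k w) =
      1 / 2 * S.metric.inner w.proj
        (w.snd + levelCoefficient φ S.metric k w • generator I M φ w.proj)
        (w.snd + levelCoefficient φ S.metric k w • generator I M φ w.proj) +
        S.potential w.proj := rfl
  have h2 : R.energy (tangentMap I I' p w) = 1 / 2 * R.metric.inner (p w.proj)
      (mfderiv I I' p w.proj w.snd) (mfderiv I I' p w.proj w.snd) +
        R.potential (p w.proj) := rfl
  rw [h1, h2, hm', hU, horizontalMetric_apply, levelCoefficient, momentum, generatorNormSq]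
  simp only [map_add, map_smul, add_apply, smul_apply,
    smul_eq_mul]
  rw [S.metric.symm w.proj w.snd (generator I M φ w.proj)]
  field_simp
  ring

/-- On the momentum level, the dynamical system of `S` projects to that of the system with
gyroscopic forces `R`. -/
theorem reduced_dynamics (hp : IsPrincipalBundle I I' F G p)
    (φ : OneParameterGroup F G) (hF : Module.finrank ℝ F = 1) {S : NaturalSystem I M}
    (hS : S.IsSymmetric G) {R : GyroscopicSystem I' M'}
    (hm' : ∀ (x : M) (u w : TangentSpace I x), R.metric.inner (p x) (mfderiv I I' p x u)
      (mfderiv I I' p x w) = horizontalMetric φ S.metric x u w)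
    (hU : IsAmendedPotential φ p S k R.potential) {γ' : Form I' M' 2}
    (hγ' : IsReducedCurvature I' φ p S.metric γ') (hR : R.force = k • γ')
    {X : FieldOnTM I M} (hX : S.IsDynamics X) {X' : FieldOnTM I' M'} (hX' : R.IsDynamics X') :
    IsReducedSystem φ p S.metric k X X' := by
  have hN : ∀ x, generatorNormSq φ S.metric x ≠ 0 :=
    fun x => (hp.generatorNormSq_pos φ hF S.metric x).ne'
  intro w hw
  -- `σ(X, Tπ Y) = σ(Tπ X, Tπ Y) = Ω'(TP X, TP Y)` and `dH(Tπ Y) = dH'(TP Y)`, where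
  -- `Ω' = σ' + k p_{M'}^* γ'`
  have hπw : levelProjection φ S.metric k w = w := levelProjection_of_mem hw
  have hπ := contMDiff_levelProjection (φ := φ) (m := S.metric) k hN
  have hXw := mfderiv_levelProjection hN hw (momentum_conserved φ hS hX w)
  refine (isNondegenerate_lagrangeTwo_add R.metric R.force).eq fun b => ?_
  rw [hX' (tangentMap I I' p w) b]
  obtain ⟨Y, rfl⟩ := hp.mfderiv_tangentMap_surjective φ hF hw b
  set Z : TangentSpace I.tangent w :=
    (mfderiv I.tangent I.tangent (levelProjection φ S.metric k) w Y : E × E) with hZ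
  have h1 : lagrangeTwo S.metric w ![X w, Z] = _ := hX w Z
  have h2 := DFunLike.congr_fun (congrFun
    (hp.pullback_levelProjection_lagrangeTwo (k := k) φ hF hm' hγ') w) ![X w, Y]
  have h3 : Form.pullback I.tangent I.tangent (levelProjection φ S.metric k)
      (lagrangeTwo S.metric) w ![X w, Y] = lagrangeTwo S.metric w ![X w, Z] := by
    refine (Form.pullback_apply_two _ _ _ _ _).trans ?_
    let σ : TangentBundle I M → (E × E) [⋀^Fin 2]→L[ℝ] ℝ := lagrangeTwo S.metric
    refine (congrArg (fun a : E × E => σ (levelProjection φ S.metric k w) ![a, Z]) hXw).trans ?_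
    exact congrArg (fun w' => σ w' ![(X w : E × E), Z]) hπw
  have h4 : mfderiv I.tangent 𝓘(ℝ, ℝ) S.energy w Z =
      mfderiv I'.tangent 𝓘(ℝ, ℝ) R.energy (tangentMap I I' p w)
        (mfderiv I.tangent I'.tangent (tangentMap I I' p) w Y) := by
    have h5 := mfderiv_comp_apply_of_eq (I := I.tangent) w
      ((contMDiff_energy S).mdifferentiable (by simp) w)
      (hπ.mdifferentiable (by simp) w) hπw Y
    have h6 := mfderiv_comp_apply (I := I.tangent) w
      ((contMDiff_energy R.toNaturalSystem).mdifferentiable (by simp) (tangentMap I I' p w))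
      (hp.contMDiff_tangentMap.mdifferentiable (by simp) w) Y
    have h7 : S.energy ∘ levelProjection φ S.metric k = R.energy ∘ tangentMap I I' p :=
      funext fun w => hp.energy_levelProjection φ hF hm' hU w
    rw [h7] at h5
    exact h5.symm.trans h6
  refine Eq.trans ?_ (h3.trans (h1.trans (congrArg Neg.neg h4)))
  refine Eq.trans ?_ h2.symm
  rw [hR]
  exact (Form.pullback_apply_two _ _ _ _ _).symm

end

end IsPrincipalBundle

section Natural

variable {E : Type*} [NormedAddCommGroup E] [NormedSpace ℝ E] [FiniteDimensional ℝ E]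
  {H : Type*} [TopologicalSpace H] {I : ModelWithCorners ℝ E H} [I.Boundaryless]
  {M : Type*} [TopologicalSpace M] [ChartedSpace H M] [IsManifold I ∞ M]

/-- A natural system is a system with gyroscopic forces whose force vanishes, so it has exactly one
dynamical system. -/
theorem NaturalSystem.exists_dynamics (S : NaturalSystem I M) :
    ∃ X : FieldOnTM I M, ∀ Y, S.IsDynamics Y ↔ Y = X := by
  have h0 : Form.d I (0 : Form I M 2) = 0 := by
    funext x
    have h := Form.d_smul (0 : ℝ) (0 : Form I M 2) x
    rw [zero_smul, zero_smul] at h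
    exact h
  have h1 : Form.IsSmooth I (0 : Form I M 2) :=
    Form.isSmooth_iff.mpr fun _ => Form.smoothAt_of_apply fun _ _ => contMDiffAt_const
  let R : GyroscopicSystem I M := ⟨S, 0, h1, h0⟩
  have hR : ∀ Y, R.IsDynamics Y ↔ S.IsDynamics Y := by
    intro Y
    have h2 : lagrangeTwo R.metric + Form.pullback I.tangent I
        (Bundle.TotalSpace.proj : TangentBundle I M → M) R.force = lagrangeTwo S.metric :=
      add_zero (lagrangeTwo S.metric)
    unfold GyroscopicSystem.IsDynamics NaturalSystem.IsDynamics
    rw [h2]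
  obtain ⟨X, hX⟩ := R.exists_dynamics
  exact ⟨X, fun Y => (hR Y).symm.trans (hX Y)⟩

end Natural

end GyroReduction

open GyroReduction in
theorem theorem5
    -- the configuration space `M`
    {E : Type*} [NormedAddCommGroup E] [NormedSpace ℝ E] [FiniteDimensional ℝ E]
    {M : Type*} [TopologicalSpace M] [ChartedSpace E M] [IsManifold 𝓘(ℝ, E) ∞ M]
    -- the reduced configuration space `M' = M / G`
    {E' : Type*} [NormedAddCommGroup E'] [NormedSpace ℝ E'] [FiniteDimensional ℝ E']
    {M' : Type*} [TopologicalSpace M'] [ChartedSpace E' M'] [IsManifold 𝓘(ℝ, E') ∞ M']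
    -- the one-parameter group `G`, acting smoothly on `M`
    {F : Type*} [NormedAddCommGroup F] [NormedSpace ℝ F] (hF : Module.finrank ℝ F = 1)
    {G : Type*} [TopologicalSpace G] [ChartedSpace F G] [Group G] [LieGroup 𝓘(ℝ, F) ∞ G]
    (φ : OneParameterGroup F G)
    [MulAction G M] [ContMDiffSMul 𝓘(ℝ, F) 𝓘(ℝ, E) ∞ G M]
    (p : M → M') (hp : IsPrincipalBundle 𝓘(ℝ, E) 𝓘(ℝ, E') F G p)
    -- the natural system with symmetry, and the momentum value
    (S : NaturalSystem 𝓘(ℝ, E) M) (hS : S.IsSymmetric G) (k : ℝ) :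
    ∃ (X : FieldOnTM 𝓘(ℝ, E) M) (X' : FieldOnTM 𝓘(ℝ, E') M')
      (γ' : Form 𝓘(ℝ, E') M' 2) (R : GyroscopicSystem 𝓘(ℝ, E') M'),
      -- `X` is the dynamical system of `(M, m, V)`
      (∀ Y, S.IsDynamics Y ↔ Y = X) ∧
      -- `X'` is the reduced system for the momentum value `k`
      (∀ Y, IsReducedSystem φ p S.metric k X Y ↔ Y = X') ∧
      -- `γ'` is the smooth closed 2-form on `M'` induced by the curvature
      (∀ β, IsReducedCurvature 𝓘(ℝ, E') φ p S.metric β ↔ β = γ') ∧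
      Form.IsSmooth 𝓘(ℝ, E') γ' ∧ Form.d 𝓘(ℝ, E') γ' = 0 ∧
      -- `R` is the system with gyroscopic forces `(M', m', V'_k, k γ')`
      (∀ μ, IsReducedMetric φ p S.metric μ ↔ μ = R.metric) ∧
      (∀ U, IsAmendedPotential φ p S k U ↔ U = R.potential) ∧
      R.force = k • γ' ∧
      -- `X'` is the dynamical system of `R`
      (∀ Y, R.IsDynamics Y ↔ Y = X') := by
  obtain ⟨X, hX⟩ := S.exists_dynamics
  obtain ⟨m', hm', hμ⟩ := hp.exists_reducedMetric φ hF hS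
  obtain ⟨U, hU, hUs⟩ := hp.exists_amendedPotential φ hF hS k
  obtain ⟨γ', hγ', hγs, hγd⟩ := hp.exists_reducedCurvature φ hF hS
  let R : GyroscopicSystem 𝓘(ℝ, E') M' :=
    { metric := m'
      potential := U
      smooth_potential := hUs
      force := k • γ'
      smooth_force := Form.isSmooth_iff.mpr fun x => (Form.isSmooth_iff.mp hγs x).smul k
      closed_force := by
        funext x
        rw [Form.d_smul, hγd]
        exact smul_zero k }
  obtain ⟨X', hX'⟩ := R.exists_dynamics
  refine ⟨X, X', γ', R, hX, fun Y => ?_, hγ', hγs, hγd, hμ, hU, rfl, hX'⟩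
  have hred : IsReducedSystem φ p S.metric k X X' :=
    hp.reduced_dynamics φ hF hS (R := R) hm' ((hU U).mpr rfl) ((hγ' γ').mpr rfl) rfl
      ((hX X).mpr rfl) ((hX' X').mpr rfl)
  refine ⟨fun hY => ?_, fun hY => hY ▸ hred⟩
  ext a : 1
  obtain ⟨w, hw, rfl⟩ := hp.exists_mem_momentumLevel φ hF S.metric k a
  exact (hY w hw).symm.trans (hred w hw)
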